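/- \textbf{Setting.} Let $r\ge 2$. Consider the exosystem $\dot\varrho=0,\ \dot w=s(\varrho,w)$, written $\dot{\mathbf w}=\mathbf s(\mathbf w)$ with $\mathbf w=(\varrho,w)\in\mathbb R^p\times\mathbb R^s$, and the plant \[ \dot z=f_0(\varrho,w,z)+f_1(\varrho,w,z,e_1)e_1,\quad \dot e_1=e_2,\ \dots,\ \dot e_{r-1}=e_r,\quad \dot e_r=q(\varrho,w,z,e_1,\dots,e_r)+u, \] $z\in\mathbb R^n$, $u\in\mathbb R$, with $s,f_0,f_1,q$ of class $C^1$. Let $P\subset\mathbb R^p$, $\mathbf W\subset P\times\mathbb R^s$ and $Z\subset\mathbb R^n$ be compact, $c>0$, $\mathbf Z=\mathbf W\times Z$. Write $\mathbf z=(\varrho,w,z)$. The zero dynamics are $\dot{\mathbf z}=\mathbf f_0(\mathbf z)$ with $\mathbf f_0(\mathbf z)=(0,s(\varrho,w),f_0(\varrho,w,z))$, forced by the control $c(\mathbf z)=-q(\varrho,w,z,0,\dots,0)$. Distances are Euclidean. For $\dot x=F(x)$ and a set $B$ on which the flow is forward complete, $\omega(B)$ is the set of all limits of sequences $x_k(t_k)$,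 where $x_k$ is a solution with $x_k(0)\in B$ and $t_k\to\infty$. Submanifolds (with boundary) are embedded and of a fixed class $C^\nu$, $1\le\nu\le\infty$, the same in the assumptions and in the conclusion. A map is $C^1$ on a compact set if it is $C^1$ on an open set containing it. \textbf{Assumptions.} (i) $\mathbf W$ is a submanifold with boundary of $\mathbb R^p\times\mathbb R^s$, and is invariant (in forward and backward time) for $\dot{\mathbf w}=\mathbf s(\mathbf w)$. (ii) There is a compact set $\mathcal Z\subset\mathbf W\times\mathbb R^n$ which contains the positive orbit of $\mathbf Z$ under $\dot{\mathbf z}=\mathbf f_0(\mathbf z)$ (all solutions starting in $\mathbf Z$ exist for all $t\ge0$); $\mathcal A_0:=\omega(\mathbf Z)$ is a submanifold with boundary of $\mathbf W\times\mathbb R^n$; and there is $d_1>0$ such that every $\mathbf z\in\mathbf W\times\mathbb R^n$ with $\mathrm{dist}(\mathbf z,\mathcal A_0)\le d_1$ lies in $\mathbf Z$. (iii) There are $M\ge1$, $a>0$ and $0<d_2\le d_1$ such that for every $\mathbf z_0\in\mathbf W\times\mathbb R^n$ with $\mathrm{dist}(\mathbf z_0,\mathcal A_0)\le d_2$ the solution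 $\mathbf z(t,\mathbf z_0)$ through $\mathbf z_0$ at $t=0$ satisfies $\mathrm{dist}(\mathbf z(t,\mathbf z_0),\mathcal A_0)\le Me^{-at}\,\mathrm{dist}(\mathbf z_0,\mathcal A_0)$ for all $t\ge0$. (iv) There are an integer $d\ge1$, a $C^1$ map $\tau:\mathcal Z\to\mathbb R^d$, a continuous map $\theta:P\to\mathbb R^k$, an observable pair $(A,C)\in\mathbb R^{d\times d}\times\mathbb R^{1\times d}$ and $C^1$ maps $\phi:\mathbb R\to\mathbb R^d$, $\Omega:\mathbb R\to\mathbb R^{d\times k}$ such that for all $\mathbf z=(\varrho,w,z)\in\mathcal A_0$ \[ \frac{\partial\tau}{\partial\mathbf z}\,\mathbf f_0(\mathbf z)=A\tau(\mathbf z)+\phi(C\tau(\mathbf z))+\Omega(C\tau(\mathbf z))\,\theta(\varrho),\qquad c(\mathbf z)=C\tau(\mathbf z). \] \textbf{Transformed plant.} Let $a_0,\dots,a_{r-2}\in\mathbb R$ be such that all roots of $\lambda^{r-1}+a_{r-2}\lambda^{r-2}+\dots+a_1\lambda+a_0$ have negative real part. For $g>0$ put $\tilde e=e_r+g^{r-1}a_0e_1+g^{r-2}a_1e_2+\dots+ga_{r-2}e_{r-1}$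 and $\tilde{\mathbf z}=(\varrho,w,z,e_1,\dots,e_{r-1})$. In these coordinates $\dot{\tilde e}=\tilde q(\tilde{\mathbf z},\tilde e,g)+u$ with \[ \tilde q=q(\varrho,w,z,e_1,\dots,e_r)+g^{r-1}a_0e_2+\dots+g^2a_{r-3}e_{r-1}+ga_{r-2}e_r,\qquad e_r=\tilde e-\sum_{i=0}^{r-2}g^{r-1-i}a_ie_{i+1}, \] so the plant with output $\tilde e$ has relative degree one. Its zero dynamics $\dot{\tilde{\mathbf z}}=\tilde{\mathbf f}_0(\tilde{\mathbf z})$ are \[ \dot\varrho=0,\ \dot w=s(\varrho,w),\ \dot z=f_0(\varrho,w,z)+f_1(\varrho,w,z,e_1)e_1,\ \dot e_i=e_{i+1}\ (1\le i\le r-2),\ \dot e_{r-1}=-\sum_{i=0}^{r-2}g^{r-1-i}a_ie_{i+1}, \] forced by the control $\tilde c(\tilde{\mathbf z})=-\tilde q(\tilde{\mathbf z},0,g)$. Let $Z_e=\{(e_1,\dots,e_{r-1}):|e_i|\le c\}$ and $\tilde{\mathbf Z}=\mathbf W\times Z\times Z_e$. \textbf{Lemma.} Suppose that assumptions (i)--(iv)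 hold. Then there is $g^\star>0$ such that for every $g\ge g^\star$ the set $\tilde{\mathcal A}_0:=\omega(\tilde{\mathbf Z})$ (for the flow of $\tilde{\mathbf f}_0$) equals $\mathcal A_0\times\{0\}$, and the following hold. (ii)$'$ There is a compact, positively invariant set $\tilde{\mathcal Z}\subset\mathbf W\times\mathbb R^n\times\mathbb R^{r-1}$ which contains the positive orbit of $\tilde{\mathbf Z}$ under $\dot{\tilde{\mathbf z}}=\tilde{\mathbf f}_0(\tilde{\mathbf z})$ (all solutions starting in $\tilde{\mathbf Z}$ exist for all $t\ge0$); $\tilde{\mathcal A}_0$ is a submanifold with boundary of $\mathbf W\times\mathbb R^n\times\mathbb R^{r-1}$; and there is $\tilde d_1>0$ such that every $\tilde{\mathbf z}\in\mathbf W\times\mathbb R^n\times\mathbb R^{r-1}$ with $\mathrm{dist}(\tilde{\mathbf z},\tilde{\mathcal A}_0)\le\tilde d_1$ lies in $\tilde{\mathbf Z}$. (iii)$'$ There are $\tilde M\ge1$, $\tilde a>0$ and $0<\tilde d_2\le\tilde d_1$ such that for every $\tilde{\mathbf z}_0\in\mathbf W\times\mathbb R^n\times\mathbb R^{r-1}$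 with $\mathrm{dist}(\tilde{\mathbf z}_0,\tilde{\mathcal A}_0)\le\tilde d_2$ the solution $\tilde{\mathbf z}(t,\tilde{\mathbf z}_0)$ of $\dot{\tilde{\mathbf z}}=\tilde{\mathbf f}_0(\tilde{\mathbf z})$ satisfies $\mathrm{dist}(\tilde{\mathbf z}(t,\tilde{\mathbf z}_0),\tilde{\mathcal A}_0)\le\tilde Me^{-\tilde at}\,\mathrm{dist}(\tilde{\mathbf z}_0,\tilde{\mathcal A}_0)$ for all $t\ge0$. (iv)$'$ With the same $d,A,C,\phi,\Omega,\theta$ as in (iv), there is a $C^1$ map $\tilde\tau:\tilde{\mathcal Z}\to\mathbb R^d$ such that for all $\tilde{\mathbf z}\in\tilde{\mathcal A}_0$ \[ \frac{\partial\tilde\tau}{\partial\tilde{\mathbf z}}\,\tilde{\mathbf f}_0(\tilde{\mathbf z})=A\tilde\tau(\tilde{\mathbf z})+\phi(C\tilde\tau(\tilde{\mathbf z}))+\Omega(C\tilde\tau(\tilde{\mathbf z}))\,\theta(\varrho),\qquad \tilde c(\tilde{\mathbf z})=C\tilde\tau(\tilde{\mathbf z}). \] -/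

import Mathlib

namespace OutputRegulation

open Filter Topology

/-! ### Euclidean spaces -/

/-- `ℝⁿ` with the Euclidean norm. -/
abbrev Euc (n : ℕ) := EuclideanSpace ℝ (Fin n)

/-- The space of the augmented exogenous input `𝐰 = col(ϱ, w)`, that is `ℝᵖ × ℝˢ`, with the
Euclidean norm. -/
abbrev ExoSpace (p s : ℕ) := WithLp 2 (Euc p × Euc s)

/-- The space of `𝐳 = col(𝐰, z)`, that is `ℝᵖ × ℝˢ × ℝⁿ`, with the Euclidean norm. -/
abbrev ZeroSpace (p s n : ℕ) := WithLp 2 (ExoSpace p s × Euc n)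

/-- The space of `𝐳̃ = col(𝐳, e₁, …, e_m)`, that is `ℝᵖ × ℝˢ × ℝⁿ × ℝᵐ`, with the Euclidean
norm (here `m = r - 1`). -/
abbrev AuxSpace (p s n m : ℕ) := WithLp 2 (ZeroSpace p s n × Euc m)

/-- The Cartesian product of two sets, inside the Euclidean product. -/
def prodSet {X Y : Type*} (S : Set X) (T : Set Y) : Set (WithLp 2 (X × Y)) :=
  {x | x.fst ∈ S ∧ x.snd ∈ T}

/-- The cube `{e ∈ ℝᵐ : |eᵢ| ≤ c for all i}`. -/
def cube (m : ℕ) (c : ℝ) : Set (Euc m) := {e | ∀ i, |e i| ≤ c}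

/-! ### Autonomous differential equations `ẋ = F(x)` -/

section Dynamics

variable {X : Type*} [NormedAddCommGroup X] [NormedSpace ℝ X]

/-- `x` solves `ẋ = F(x)` on `[0, ∞)`. -/
def IsForwardSolution (F : X → X) (x : ℝ → X) : Prop :=
  IsIntegralCurveOn x (fun _ => F) (Set.Ici 0)

/-- All solutions of `ẋ = F(x)` that start in `B` extend to `[0, ∞)` (stated as existence of a
solution on `[0, ∞)`; it is used for `F` of class `C¹`, for which solutions are unique). -/
def ForwardCompleteOn (F : X → X) (B : Set X) : Prop :=
  ∀ x₀ ∈ B, ∃ x : ℝ → X, IsForwardSolution F x ∧ x 0 = x₀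

/-- The positive orbit of `B` under the flow of `ẋ = F(x)`. -/
def positiveOrbit (F : X → X) (B : Set X) : Set X :=
  {y | ∃ x : ℝ → X, IsForwardSolution F x ∧ x 0 ∈ B ∧ ∃ t : ℝ, 0 ≤ t ∧ x t = y}

/-- The `ω`-limit set of the set `B`: all limits of sequences `x_k(t_k)`, where `x_k` is a
solution with `x_k(0) ∈ B` and `t_k → ∞`. -/
def limitSet (F : X → X) (B : Set X) : Set X :=
  {y | ∃ (x : ℕ → ℝ → X) (t : ℕ → ℝ), (∀ k, IsForwardSolution F (x k) ∧ x k 0 ∈ B) ∧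
    Tendsto t atTop atTop ∧ Tendsto (fun k => x k (t k)) atTop (𝓝 y)}

/-- `S` is invariant (in forward and backward time) for `ẋ = F(x)`. -/
def IsInvariantSet (F : X → X) (S : Set X) : Prop :=
  ∀ x₀ ∈ S, ∃ x : ℝ → X, IsIntegralCurve x (fun _ => F) ∧ x 0 = x₀ ∧ ∀ t, x t ∈ S

/-- `S` is positively invariant for `ẋ = F(x)`. -/
def IsPositivelyInvariantSet (F : X → X) (S : Set X) : Prop :=
  ForwardCompleteOn F S ∧ positiveOrbit F S ⊆ S

/-- `S` is an (embedded) differential submanifold with boundary, of class `C^ν` and of some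
dimension `k`, of the finite dimensional space `X`: near each of its points some
`C^ν`-diffeomorphism between open subsets of `X` carries `S` onto an open piece of
`{y ∈ L : 0 ≤ ℓ y}`, where `L` is a linear subspace of dimension `k` and `ℓ` a linear functional.
(This set is a half-space of `L` if `ℓ ≠ 0` on `L`, and it is `L` if `ℓ = 0` on `L`.) -/
def IsSubmanifoldWithBoundary (ν : ℕ∞) (S : Set X) : Prop :=
  ∃ k : ℕ, ∀ x ∈ S, ∃ (Φ : OpenPartialHomeomorph X X) (L : Submodule ℝ X) (ℓ : X →L[ℝ] ℝ),
    Module.finrank ℝ L = k ∧ x ∈ Φ.source ∧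
    ContDiffOn ℝ ν Φ Φ.source ∧ ContDiffOn ℝ ν Φ.symm Φ.target ∧
    Φ '' (S ∩ Φ.source) = {y | y ∈ L ∧ 0 ≤ ℓ y} ∩ Φ.target

/-- Assumption (ii), for the dynamics `ẋ = F(x)` on the set `M` (the product of the exosystem's
set of initial conditions with a Euclidean space), the set `B` of initial conditions, the compact
set `K` and the number `d₁`. -/
structure AssumptionII (ν : ℕ∞) (F : X → X) (M B K : Set X) (d₁ : ℝ) : Prop where
  isCompact : IsCompact K
  subset : K ⊆ M
  forwardComplete : ForwardCompleteOn F B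
  orbit_subset : positiveOrbit F B ⊆ K
  limitSet_subset : limitSet F B ⊆ M
  limitSet_submanifold : IsSubmanifoldWithBoundary ν (limitSet F B)
  pos : 0 < d₁
  near : ∀ x ∈ M, Metric.infDist x (limitSet F B) ≤ d₁ → x ∈ B

/-- Assumption (iii): local exponential attractivity of the set `A`, for the dynamics `ẋ = F(x)`
on the set `M`, with constants `N`, `a` and `d₂ ≤ d₁`. -/
structure AssumptionIII (F : X → X) (M A : Set X) (d₁ N a d₂ : ℝ) : Prop where
  one_le : 1 ≤ N
  rate_pos : 0 < a
  pos : 0 < d₂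
  le : d₂ ≤ d₁
  attractive : ∀ x : ℝ → X, IsForwardSolution F x → x 0 ∈ M → Metric.infDist (x 0) A ≤ d₂ →
    ∀ t, 0 ≤ t → Metric.infDist (x t) A ≤ N * Real.exp (-a * t) * Metric.infDist (x 0) A

/-- `τ` is of class `C¹` on the (arbitrary) set `K`: it is `C¹` on an open set containing `K`. -/
def IsC1On {Y : Type*} [NormedAddCommGroup Y] [NormedSpace ℝ Y] (τ : X → Y) (K : Set X) : Prop :=
  ∃ U : Set X, IsOpen U ∧ K ⊆ U ∧ ContDiffOn ℝ 1 τ U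

/-- `τ` is `C¹` on `K` and has the immersion property on the set `A`: for all `x ∈ A`,
`(∂τ/∂x) F(x) = 𝒜 τ(x) + φ(𝒞 τ(x)) + Ω(𝒞 τ(x)) θ(ϱ)` and `c(x) = 𝒞 τ(x)`, where `ϱ = par x` is
the parameter component of the point `x`. -/
structure Immersion {p d k : ℕ} (𝒜 : Matrix (Fin d) (Fin d) ℝ) (𝒞 : Matrix (Fin 1) (Fin d) ℝ)
    (φ : ℝ → Fin d → ℝ) (Ω : ℝ → Matrix (Fin d) (Fin k) ℝ) (θ : Euc p → Fin k → ℝ)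
    (F : X → X) (c : X → ℝ) (par : X → Euc p) (K A : Set X) (τ : X → Fin d → ℝ) : Prop where
  isC1On : IsC1On τ K
  deriv_eq : ∀ x ∈ A, fderiv ℝ τ x (F x) =
    𝒜.mulVec (τ x) + φ (𝒞.mulVec (τ x) 0) + (Ω (𝒞.mulVec (τ x) 0)).mulVec (θ (par x))
  output_eq : ∀ x ∈ A, c x = 𝒞.mulVec (τ x) 0

end Dynamics

/-- Observability of the pair `(𝒜, 𝒞)`: the observability matrix, with rows
`𝒞, 𝒞𝒜, …, 𝒞𝒜^(d-1)`, has rank `d`. -/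
def IsObservable {d : ℕ} (𝒜 : Matrix (Fin d) (Fin d) ℝ) (𝒞 : Matrix (Fin 1) (Fin d) ℝ) : Prop :=
  (Matrix.of fun i j : Fin d => (𝒞 * 𝒜 ^ (i : ℕ)) 0 j).rank = d

/-- All the roots of `λᵐ + a_{m-1} λ^{m-1} + … + a₁ λ + a₀` have negative real part. -/
def IsHurwitz {m : ℕ} (a : Fin m → ℝ) : Prop :=
  ∀ z : ℂ, z ^ m + ∑ i : Fin m, (a i : ℂ) * z ^ (i : ℕ) = 0 → z.re < 0

/-! ### The plant, its zero dynamics, and the transformed plant -/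

/-- The data of the exosystem `ϱ̇ = 0`, `ẇ = s(ϱ, w)` and of the plant of relative degree
`r = m + 1`
`ż = f₀(ϱ,w,z) + f₁(ϱ,w,z,e₁) e₁`, `ė₁ = e₂`, …, `ė_{r-1} = e_r`,
`ė_r = q(ϱ,w,z,e₁,…,e_r) + u`, all of class `C¹`. The coordinate `eᵢ` has index `i - 1`. -/
structure Plant (p s n m : ℕ) where
  exo : ExoSpace p s → Euc s
  f₀ : ZeroSpace p s n → Euc n
  f₁ : ZeroSpace p s n → ℝ → Euc n
  q : ZeroSpace p s n → Euc (m + 1) → ℝ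
  contDiff_exo : ContDiff ℝ 1 exo
  contDiff_f₀ : ContDiff ℝ 1 f₀
  contDiff_f₁ : ContDiff ℝ 1 (fun x : ZeroSpace p s n × ℝ => f₁ x.1 x.2)
  contDiff_q : ContDiff ℝ 1 (fun x : ZeroSpace p s n × Euc (m + 1) => q x.1 x.2)

namespace Plant

variable {p s n m : ℕ}

/-- The augmented exosystem `𝐰̇ = 𝐬(𝐰) = (0, s(ϱ, w))`. -/
def exoField (S : Plant p s n m) (w : ExoSpace p s) : ExoSpace p s :=
  WithLp.toLp 2 (0, S.exo w)

/-- The augmented zero dynamics `𝐳̇ = 𝐟₀(𝐳) = (𝐬(𝐰), f₀(ϱ, w, z))`. -/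
def zeroField (S : Plant p s n m) (z : ZeroSpace p s n) : ZeroSpace p s n :=
  WithLp.toLp 2 (S.exoField z.fst, S.f₀ z)

/-- The control `c(𝐳) = -q(ϱ, w, z, 0, …, 0)` that forces the zero dynamics. -/
def friend (S : Plant p s n m) (z : ZeroSpace p s n) : ℝ := -S.q z 0

/-- `g^{r-1} a₀ e₁ + g^{r-2} a₁ e₂ + … + g a_{r-2} e_{r-1}`; the transformation of the plant is
`e_r ↦ ẽ = e_r + gainSum g a (e₁, …, e_{r-1})`. -/
def gainSum (g : ℝ) (a : Fin m → ℝ) (e : Euc m) : ℝ :=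
  ∑ i : Fin m, g ^ (m - (i : ℕ)) * a i * e i

/-- The vector `(e₁, …, e_{r-1}, e_r)`, with `e_r = ẽ - gainSum g a (e₁, …, e_{r-1})`. -/
def fullError (g : ℝ) (a : Fin m → ℝ) (e : Euc m) (et : ℝ) : Euc (m + 1) :=
  WithLp.toLp 2 (Fin.snoc (α := fun _ => ℝ) (fun i => e i) (et - gainSum g a e))

/-- The right-hand side `(e₂, …, e_{r-1}, -gainSum g a (e₁, …, e_{r-1}))` of the equation of
`(e₁, …, e_{r-1})` for `ẽ = 0`. -/
def errorField (g : ℝ) (a : Fin m → ℝ) (e : Euc m) : Euc m :=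
  WithLp.toLp 2 fun j => if h : (j : ℕ) + 1 < m then e ⟨(j : ℕ) + 1, h⟩ else -gainSum g a e

/-- The augmented zero dynamics `𝐟̃₀` of the transformed plant:
`𝐳 = (𝐰, z)` obeys `𝐰̇ = 𝐬(𝐰)`, `ż = f₀(ϱ,w,z) + f₁(ϱ,w,z,e₁) e₁`, and `(e₁, …, e_{r-1})` obeys
`errorField`. -/
def auxField [NeZero m] (S : Plant p s n m) (g : ℝ) (a : Fin m → ℝ) (x : AuxSpace p s n m) :
    AuxSpace p s n m :=
  WithLp.toLp 2
    (WithLp.toLp 2 (S.exoField x.fst.fst, S.f₀ x.fst + x.snd 0 • S.f₁ x.fst (x.snd 0)),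
      errorField g a x.snd)

/-- The function `q̃` of the transformed plant, whose last equation is `ẽ' = q̃(𝐳̃, ẽ, g) + u`.
It is `q(ϱ,w,z,e₁,…,e_r) + g^{r-1} a₀ e₂ + … + g² a_{r-3} e_{r-1} + g a_{r-2} e_r`, where `e_r`
stands for `ẽ - gainSum g a (e₁, …, e_{r-1})`. -/
def auxQ (S : Plant p s n m) (g : ℝ) (a : Fin m → ℝ) (x : AuxSpace p s n m) (et : ℝ) : ℝ :=
  S.q x.fst (fullError g a x.snd et) +
    ∑ i : Fin m, g ^ (m - (i : ℕ)) * a i * fullError g a x.snd et i.succ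

/-- The control `c̃(𝐳̃) = -q̃(𝐳̃, 0, g)` that forces the zero dynamics of the transformed plant. -/
def auxFriend (S : Plant p s n m) (g : ℝ) (a : Fin m → ℝ) (x : AuxSpace p s n m) : ℝ :=
  -S.auxQ g a x 0

end Plant

end OutputRegulation

open OutputRegulation

/-!
The error `(e₁, …, e_{r-1})` of the transformed zero dynamics obeys an autonomous linear equation,
and it enters the equation of `𝐳` only through `e₁`. So the transformed zero dynamics are the
original ones, forced by the decaying input `u = e₁`: `𝐳̇ = H(𝐳, u)` with `H(𝐳, 0) = 𝐟₀(𝐳)`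
(`Plant.forcedField`).

In the coordinates `g^{1-i} eᵢ` the error equation is `g` times the companion system of the Hurwitz
polynomial. Since `exp` of a Hurwitz operator has spectral radius less than one
(`spectralRadius_exp_lt_one`), the error decays like `exp (-l g t)`, and `e₁`, which the scaling
does not change, decays without peaking, with a constant that does not depend on `g ≥ 1`
(`exists_error_le`).

Consequently, on a fixed time interval, the input `e₁` is bounded and, outside an arbitrarily short
initial layer, arbitrarily small if `g` is large. By Gronwall's inequality the forced trajectories
from `𝐙` shadow the unforced ones up to a time at which the latter are close to `𝒜₀`; from there on,
the local exponential attractivity of `𝒜₀` contracts the distance to `𝒜₀` by a fixed factor on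
intervals of a fixed length, up to an error proportional to the input
(`infDist_le_exp_of_forced`). This gives existence for all times and uniform convergence to
`𝒜₀ × {0}` from `𝐙 × Z_e` (`exists_forced_semiglobal`), and local exponential convergence
(`exists_forced_local`). In these arguments `H` is replaced by a globally Lipschitz field that agrees
with it near the compact set `K`; the trajectories found never leave the region of agreement.

The trajectories from `𝐙 × Z_e` stay over a small neighbourhood of `K`, on which `τ` is still
defined. So the closure of their positive orbit serves as the compact positively invariant set, and
`τ`, as a function that does not depend on the error, as the immersion.
-/

section

open Set Filter Topology

/-! ### Autonomous and time-dependent differential equations -/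

/-- On a bounded set, a `C¹` map of a finite dimensional space agrees with a bounded, globally
Lipschitz map. -/
theorem exists_lipschitzWith_bounded_eqOn {X Y : Type*} [NormedAddCommGroup X] [NormedSpace ℝ X]
    [FiniteDimensional ℝ X] [NormedAddCommGroup Y] [NormedSpace ℝ Y] {F : X → Y}
    (hF : ContDiff ℝ 1 F) {Q : Set X} (hQ : Bornology.IsBounded Q) :
    ∃ (G : X → Y) (L R : NNReal), LipschitzWith L G ∧ (∀ x, ‖G x‖ ≤ R) ∧ EqOn G F Q := by
  obtain ⟨r, hr⟩ := hQ.subset_closedBall (0 : X)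
  let χ : ContDiffBump (0 : X) := ⟨max r 1, max r 1 + 1, by positivity, by linarith⟩
  have hc : HasCompactSupport (fun x => χ x • F x) := χ.hasCompactSupport.smul_right
  have hd : ContDiff ℝ 1 (fun x => χ x • F x) := χ.contDiff.smul hF
  obtain ⟨L, hL⟩ := hd.lipschitzWith_of_hasCompactSupport hc (by simp)
  obtain ⟨R, hR⟩ := hc.exists_bound_of_continuous hd.continuous
  refine ⟨fun x => χ x • F x, L, R.toNNReal, hL, fun x => (hR x).trans (Real.le_coe_toNNReal R), ?_⟩
  intro x hx
  have h1 : χ x = 1 := χ.one_of_mem_closedBall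
    (Metric.closedBall_subset_closedBall (le_max_left r 1) (hr hx))
  simp [h1]

section

variable {X : Type*} [NormedAddCommGroup X] [NormedSpace ℝ X]

theorem IsIntegralCurveOn.hasDerivWithinAt_Ici {x : ℝ → X} {v : ℝ → X → X} {T t : ℝ}
    (hx : IsIntegralCurveOn x v (Icc 0 T)) (ht : t ∈ Ico 0 T) :
    HasDerivWithinAt x (v t (x t)) (Ici t) t :=
  (hx t (Ico_subset_Icc_self ht)).mono_of_mem_nhdsWithin (Icc_mem_nhdsGE_of_mem ht)

theorem IsIntegralCurveOn.congr_field {x : ℝ → X} {v v' : ℝ → X → X} {s : Set ℝ}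
    (hx : IsIntegralCurveOn x v s) (h : ∀ t ∈ s, v t (x t) = v' t (x t)) :
    IsIntegralCurveOn x v' s := fun t ht => h t ht ▸ hx t ht

/-- Solutions that start at time `0` are unique when the field is Lipschitz along them. -/
theorem IsIntegralCurveOn.eqOn_Icc {x y : ℝ → X} {v : ℝ → X → X} {T : ℝ} {L : NNReal}
    (hv : ∀ t, LipschitzWith L (v t)) (hx : IsIntegralCurveOn x v (Icc 0 T))
    (hy : IsIntegralCurveOn y v (Icc 0 T)) (h0 : x 0 = y 0) : EqOn x y (Icc 0 T) := by
  intro t ht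
  have := dist_le_of_trajectories_ODE (δ := 0) hv hx.continuousOn
    (fun t ht => hx.hasDerivWithinAt_Ici ht)
    hy.continuousOn (fun t ht => hy.hasDerivWithinAt_Ici ht) (by simp [h0]) t ht
  simpa using this

/-- Solutions of an autonomous equation with `C¹` right-hand side are unique. -/
theorem IsIntegralCurveOn.eqOn_Icc_of_contDiff [FiniteDimensional ℝ X] {x y : ℝ → X} {F : X → X}
    {T : ℝ} (hF : ContDiff ℝ 1 F) (hx : IsIntegralCurveOn x (fun _ => F) (Icc 0 T))
    (hy : IsIntegralCurveOn y (fun _ => F) (Icc 0 T)) (h0 : x 0 = y 0) : EqOn x y (Icc 0 T) := by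
  have hb : Bornology.IsBounded (x '' Icc 0 T ∪ y '' Icc 0 T) :=
    ((isCompact_Icc.image_of_continuousOn hx.continuousOn).union
      (isCompact_Icc.image_of_continuousOn hy.continuousOn)).isBounded
  obtain ⟨G, L, -, hL, -, hG⟩ := exists_lipschitzWith_bounded_eqOn hF hb
  exact IsIntegralCurveOn.eqOn_Icc (v := fun _ => G) (fun _ => hL)
    (hx.congr_field fun t ht => (hG (Or.inl ⟨t, ht, rfl⟩)).symm)
    (hy.congr_field fun t ht => (hG (Or.inr ⟨t, ht, rfl⟩)).symm) h0

theorem OutputRegulation.IsForwardSolution.eqOn [FiniteDimensional ℝ X] {x y : ℝ → X} {F : X → X}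
    (hF : ContDiff ℝ 1 F) (hx : IsForwardSolution F x) (hy : IsForwardSolution F y)
    (h0 : x 0 = y 0) {t : ℝ} (ht : 0 ≤ t) : x t = y t :=
  IsIntegralCurveOn.eqOn_Icc_of_contDiff hF (IsIntegralCurveOn.mono hx Icc_subset_Ici_self)
    (IsIntegralCurveOn.mono hy Icc_subset_Ici_self) h0 ⟨ht, le_rfl⟩

theorem IsIntegralCurveOn.shift {x : ℝ → X} {v : ℝ → X → X}
    (hx : IsIntegralCurveOn x v (Ici 0)) {s : ℝ} (hs : 0 ≤ s) :
    IsIntegralCurveOn (fun t => x (t + s)) (fun t => v (t + s)) (Ici 0) := by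
  intro t ht
  have h := hx (t + s) (add_nonneg ht hs)
  have h2 : HasDerivWithinAt (fun t : ℝ => t + s) 1 (Ici 0) t :=
    ((hasDerivAt_id t).add_const s).hasDerivWithinAt
  simpa [Function.comp_def] using h.scomp t h2 (fun t ht => add_nonneg ht hs)

theorem OutputRegulation.IsForwardSolution.shift {x : ℝ → X} {F : X → X}
    (hx : IsForwardSolution F x) {s : ℝ} (hs : 0 ≤ s) : IsForwardSolution F fun t => x (t + s) :=
  IsIntegralCurveOn.shift hx hs

/-- A bounded field that is Lipschitz in space, uniformly in time, has global forward solutions. -/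
theorem exists_isIntegralCurveOn_Ici [CompleteSpace X] {v : ℝ → X → X} {L R : NNReal}
    (hL : ∀ t, LipschitzWith L (v t)) (hR : ∀ t x, ‖v t x‖ ≤ R)
    (hc : ∀ x, Continuous fun t => v t x) (x₀ : X) :
    ∃ x : ℝ → X, x 0 = x₀ ∧ IsIntegralCurveOn x v (Ici 0) := by
  have key : ∀ n : ℕ, ∃ x : ℝ → X, x 0 = x₀ ∧ IsIntegralCurveOn x v (Icc 0 (n : ℝ)) := by
    intro n
    -- the radius of the ball is the distance that a curve of speed at most `R` covers
    have hp : IsPicardLindelof v (tmin := 0) (tmax := n) ⟨0, by simp⟩ x₀ (R * n) 0 R L :=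
      { lipschitzOnWith := fun t _ => (hL t).lipschitzOnWith
        continuousOn := fun x _ => (hc x).continuousOn
        norm_le := fun t _ x _ => hR t x
        mul_max_le := by simp }
    obtain ⟨x, hx0, hx⟩ := hp.exists_eq_forall_mem_Icc_hasDerivWithinAt₀
    exact ⟨x, hx0, hx⟩
  choose x hx0 hx using key
  have agree : ∀ n k : ℕ, n ≤ k → EqOn (x n) (x k) (Icc 0 (n : ℝ)) := fun n k hnk =>
    IsIntegralCurveOn.eqOn_Icc hL (hx n)
      ((hx k).mono (Icc_subset_Icc_right (by exact_mod_cast hnk))) (by rw [hx0, hx0])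
  refine ⟨fun t => x (⌊t⌋₊ + 1) t, by simp [hx0], fun t ht => ?_⟩
  have hle : ∀ s : ℝ, 0 ≤ s → s ≤ ((⌊s⌋₊ + 1 : ℕ) : ℝ) := fun s _ => by
    push_cast; exact (Nat.lt_floor_add_one s).le
  set n := ⌊t⌋₊ + 1 with hn
  have htn : t < (n : ℝ) := by rw [hn]; push_cast; exact Nat.lt_floor_add_one t
  have h1 : HasDerivWithinAt (x n) (v t (x n t)) (Ici 0) t :=
    (hx n t ⟨ht, htn.le⟩).mono_of_mem_nhdsWithin
      (inter_mem_nhdsWithin (Ici (0 : ℝ)) (Iic_mem_nhds htn))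
  refine h1.congr_of_eventuallyEq ?_ rfl
  filter_upwards [self_mem_nhdsWithin, mem_nhdsWithin_of_mem_nhds (Iio_mem_nhds htn)] with s hs hsn
  have hfl : ⌊s⌋₊ + 1 ≤ n := by
    have := (Nat.floor_lt (show (0 : ℝ) ≤ s from hs)).2 (show s < n from hsn)
    omega
  exact agree _ _ hfl ⟨hs, hle s hs⟩

end

theorem gronwallBound_le {δ K ε x : ℝ} (hK : 0 ≤ K) (hε : 0 ≤ ε) :
    gronwallBound δ K ε x ≤ (δ + ε * x) * Real.exp (K * x) := by
  rcases hK.eq_or_lt with rfl | hK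
  · simp [gronwallBound_K0]
  · rw [gronwallBound_of_K_ne_0 hK.ne', add_mul]
    have h1 : Real.exp (K * x) - 1 ≤ K * x * Real.exp (K * x) := by
      have h2 := Real.add_one_le_exp (-(K * x))
      have h3 : Real.exp (-(K * x)) * Real.exp (K * x) = 1 := by rw [← Real.exp_add]; simp
      nlinarith [Real.exp_pos (K * x)]
    have h4 : ε / K * (Real.exp (K * x) - 1) ≤ ε / K * (K * x * Real.exp (K * x)) := by gcongr
    have h5 : ε / K * (K * x * Real.exp (K * x)) = ε * x * Real.exp (K * x) := by field_simp
    linarith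

section

variable {X : Type*} [NormedAddCommGroup X] [NormedSpace ℝ X]

/-- Gronwall's inequality for two solutions of `ẋ = G(x, u(t))` and `ẏ = G(y, 0)`. -/
theorem dist_le_of_perturbation {G : X × ℝ → X} {L : NNReal} (hG : LipschitzWith L G)
    {x y : ℝ → X} {u : ℝ → ℝ} {T δ ε : ℝ} (hε : 0 ≤ ε)
    (hx : IsIntegralCurveOn x (fun t z => G (z, u t)) (Icc 0 T))
    (hy : IsIntegralCurveOn y (fun _ z => G (z, 0)) (Icc 0 T))
    (h0 : dist (x 0) (y 0) ≤ δ) (hu : ∀ t ∈ Icc 0 T, |u t| ≤ ε) {t : ℝ} (ht : t ∈ Icc 0 T) :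
    dist (x t) (y t) ≤ (δ + L * ε * t) * Real.exp (L * t) := by
  have hL : ∀ t : ℝ, LipschitzWith L ((fun _ z => G (z, 0)) t : X → X) := fun t => by
    refine LipschitzWith.of_dist_le_mul fun a b => (hG.dist_le_mul _ _).trans ?_
    simp [Prod.dist_eq]
  have h := dist_le_of_approx_trajectories_ODE (εf := L * ε) (εg := 0) hL hx.continuousOn
    (fun t ht => hx.hasDerivWithinAt_Ici ht) (fun t ht => by
      refine (hG.dist_le_mul _ _).trans ?_
      have := hu t (Ico_subset_Icc_self ht)
      rw [Prod.dist_eq]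
      simp only [dist_self, Real.dist_eq, sub_zero]
      rw [max_eq_right (abs_nonneg _)]
      gcongr)
    hy.continuousOn (fun t ht => hy.hasDerivWithinAt_Ici ht) (fun t ht => by simp) h0 t ht
  rw [sub_zero, add_zero] at h
  exact h.trans (gronwallBound_le L.2 (by positivity))

/-- The closure of a bounded positively invariant set of a `C¹` field is positively invariant. -/
theorem isPositivelyInvariantSet_closure [FiniteDimensional ℝ X] {F : X → X}
    (hF : ContDiff ℝ 1 F) {S : Set X} (hS : IsPositivelyInvariantSet F S)
    (hb : Bornology.IsBounded S) : IsPositivelyInvariantSet F (closure S) := by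
  have : CompleteSpace X := FiniteDimensional.complete ℝ X
  obtain ⟨G, L, R, hL, hR, hG⟩ := exists_lipschitzWith_bounded_eqOn hF hb.closure
  have key : ∀ y ∈ closure S, ∃ x : ℝ → X, x 0 = y ∧ IsForwardSolution F x ∧
      ∀ t, 0 ≤ t → x t ∈ closure S := by
    intro y hy
    obtain ⟨x, hx0, hx⟩ := exists_isIntegralCurveOn_Ici (v := fun _ => G) (fun _ => hL)
      (fun _ => hR) (fun _ => continuous_const) y
    have hmem : ∀ t, 0 ≤ t → x t ∈ closure S := by
      intro t ht
      rw [Metric.mem_closure_iff]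
      intro ε hε
      obtain ⟨z, hzS, hz⟩ := Metric.mem_closure_iff.1 hy (ε / Real.exp (L * t)) (by positivity)
      obtain ⟨ξ, hξ, hξ0⟩ := hS.1 z hzS
      have hξS : ∀ s, 0 ≤ s → ξ s ∈ S := fun s hs => hS.2 ⟨ξ, hξ, hξ0 ▸ hzS, s, hs, rfl⟩
      have hξG : IsIntegralCurveOn ξ (fun _ => G) (Ici 0) :=
        IsIntegralCurveOn.congr_field hξ fun s hs => (hG (subset_closure (hξS s hs))).symm
      refine ⟨ξ t, hξS t ht, ?_⟩
      have h := dist_le_of_trajectories_ODE (v := fun _ => G) (δ := dist y z) (fun _ => hL)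
        (hx.mono (Icc_subset_Ici_self : Icc 0 t ⊆ Ici 0)).continuousOn
        (fun s hs => (hx.mono Icc_subset_Ici_self).hasDerivWithinAt_Ici hs)
        (hξG.mono Icc_subset_Ici_self).continuousOn
        (fun s hs => (hξG.mono Icc_subset_Ici_self).hasDerivWithinAt_Ici hs)
        (by rw [hx0, hξ0]) t ⟨ht, le_rfl⟩
      rw [lt_div_iff₀ (Real.exp_pos _)] at hz
      rw [sub_zero] at h
      linarith
    exact ⟨x, hx0, hx.congr_field fun t ht => hG (hmem t ht), hmem⟩
  refine ⟨fun y hy => ?_, ?_⟩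
  · obtain ⟨x, hx0, hx, -⟩ := key y hy
    exact ⟨x, hx, hx0⟩
  · rintro _ ⟨ξ, hξ, hξ0, t, ht, rfl⟩
    obtain ⟨x, hx0, hx, hmem⟩ := key _ hξ0
    rw [hξ.eqOn hF hx hx0.symm ht]
    exact hmem t ht

theorem isPositivelyInvariantSet_positiveOrbit [FiniteDimensional ℝ X] {F : X → X}
    (hF : ContDiff ℝ 1 F) (B : Set X) : IsPositivelyInvariantSet F (positiveOrbit F B) := by
  constructor
  · rintro _ ⟨x, hx, -, t, ht, rfl⟩
    exact ⟨_, hx.shift ht, by simp⟩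
  · rintro _ ⟨ξ, hξ, ⟨x, hx, hx0, t, ht, h⟩, s, hs, rfl⟩
    refine ⟨x, hx, hx0, s + t, add_nonneg hs ht, ?_⟩
    exact (hx.shift ht).eqOn hF hξ (by simpa using h) hs

/-! ### Limit sets -/

theorem mem_limitSet_iff {F : X → X} {B : Set X} {y : X} :
    y ∈ limitSet F B ↔ ∀ ε > 0, ∀ T : ℝ, ∃ x : ℝ → X, IsForwardSolution F x ∧ x 0 ∈ B ∧
      ∃ t, T ≤ t ∧ dist (x t) y < ε := by
  constructor
  · rintro ⟨x, t, hx, ht, hy⟩ ε hε T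
    obtain ⟨k, hk, hk'⟩ := ((ht.eventually_ge_atTop T).and
      (Metric.tendsto_nhds.1 hy ε hε)).exists
    exact ⟨x k, (hx k).1, (hx k).2, t k, hk, hk'⟩
  · intro h
    choose x hx hx0 t ht hd using fun k : ℕ => h (1 / ((k : ℝ) + 1)) (by positivity) k
    refine ⟨x, t, fun k => ⟨hx k, hx0 k⟩, tendsto_atTop_mono ht tendsto_natCast_atTop_atTop, ?_⟩
    rw [tendsto_iff_dist_tendsto_zero]
    exact squeeze_zero (fun _ => dist_nonneg) (fun k => (hd k).le)
      tendsto_one_div_add_atTop_nhds_zero_nat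

theorem isClosed_limitSet (F : X → X) (B : Set X) : IsClosed (limitSet F B) := by
  refine isClosed_of_closure_subset fun y hy => mem_limitSet_iff.2 fun ε hε T => ?_
  obtain ⟨z, hz, hyz⟩ := Metric.mem_closure_iff.1 hy (ε / 2) (by positivity)
  obtain ⟨x, hx, hx0, t, ht, hd⟩ := mem_limitSet_iff.1 hz (ε / 2) (by positivity) T
  refine ⟨x, hx, hx0, t, ht, ?_⟩
  have := dist_triangle_right (x t) y z
  linarith

theorem limitSet_subset_of_isCompact {F : X → X} {B K : Set X} (hK : IsCompact K)
    (hB : positiveOrbit F B ⊆ K) : limitSet F B ⊆ K := by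
  rintro y ⟨x, t, hx, ht, hy⟩
  refine hK.isClosed.mem_of_tendsto hy ?_
  filter_upwards [ht.eventually_ge_atTop 0] with k hk
  exact hB ⟨x k, (hx k).1, (hx k).2, t k, hk, rfl⟩

/-- Points on trajectories from `B` at times tending to infinity accumulate at the limit set. -/
theorem exists_subseq_tendsto_limitSet {F : X → X} {B K : Set X} (hK : IsCompact K)
    (hB : positiveOrbit F B ⊆ K) {x : ℕ → ℝ → X} {t : ℕ → ℝ}
    (hx : ∀ k, IsForwardSolution F (x k) ∧ x k 0 ∈ B) (ht : ∀ k : ℕ, (k : ℝ) ≤ t k) :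
    ∃ y ∈ limitSet F B, ∃ σ : ℕ → ℕ, StrictMono σ ∧
      Tendsto (fun k => x (σ k) (t (σ k))) atTop (𝓝 y) := by
  obtain ⟨y, -, σ, hσ, hy⟩ := hK.tendsto_subseq (x := fun k => x k (t k)) fun k =>
    hB ⟨x k, (hx k).1, (hx k).2, t k, k.cast_nonneg.trans (ht k), rfl⟩
  exact ⟨y, ⟨fun k => x (σ k), fun k => t (σ k), fun k => hx _,
    (tendsto_atTop_mono ht tendsto_natCast_atTop_atTop).comp hσ.tendsto_atTop, hy⟩, σ, hσ, hy⟩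

theorem limitSet_nonempty {F : X → X} {B K : Set X} (hK : IsCompact K)
    (hB : positiveOrbit F B ⊆ K) (hf : ForwardCompleteOn F B) (hne : B.Nonempty) :
    (limitSet F B).Nonempty := by
  obtain ⟨b, hb⟩ := hne
  obtain ⟨x, hx, hx0⟩ := hf b hb
  obtain ⟨y, hy, -⟩ := exists_subseq_tendsto_limitSet hK hB (x := fun _ => x) (t := fun k => k)
    (fun _ => ⟨hx, hx0 ▸ hb⟩) fun _ => le_rfl
  exact ⟨y, hy⟩

/-- The limit set of a set whose positive orbit is relatively compact attracts it uniformly. -/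
theorem exists_forall_infDist_limitSet_le {F : X → X} {B K : Set X} (hK : IsCompact K)
    (hB : positiveOrbit F B ⊆ K) {ε : ℝ} (hε : 0 < ε) :
    ∃ T : ℝ, ∀ x : ℝ → X, IsForwardSolution F x → x 0 ∈ B → ∀ t, T ≤ t →
      Metric.infDist (x t) (limitSet F B) ≤ ε := by
  by_contra! h
  choose x hx hx0 t ht hd using fun k : ℕ => h k
  obtain ⟨y, hy, σ, -, hlim⟩ := exists_subseq_tendsto_limitSet hK hB
    (fun k => ⟨hx k, hx0 k⟩) ht
  have h1 := ((Metric.continuous_infDist_pt (limitSet F B)).tendsto y).comp hlim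
  rw [Metric.infDist_zero_of_mem hy] at h1
  exact absurd (ge_of_tendsto' h1 fun k => (hd (σ k)).le) (not_le.2 hε)

end

/-! ### Exponentially attractive limit sets under vanishing perturbations -/

section

variable {E : Type*} [NormedAddCommGroup E] [NormedSpace ℝ E]
  {H G : E × ℝ → E} {M B K : Set E} {ν : ℕ∞} {d₁ N α d₂ δ r : ℝ} {L : NNReal}

/-- The set `M` is positively invariant for `ż = H(z, u(t))`, whatever the input `u`. -/
def IsForcedInvariant (H : E × ℝ → E) (M : Set E) : Prop :=
  ∀ (u : ℝ → ℝ) (z : ℝ → E) (T : ℝ), 0 ≤ T →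
    IsIntegralCurveOn z (fun t x => H (x, u t)) (Icc 0 T) → z 0 ∈ M → z T ∈ M

/-- On a time interval of length `T`, the forced trajectory shadows the trajectory of the unforced
system that starts at the same point, so that it inherits the attraction of the limit set up to an
error proportional to the size of the input. -/
theorem infDist_le_of_forced (hM : IsForcedInvariant H M)
    (hii : AssumptionII ν (fun z => H (z, 0)) M B K d₁)
    (hiii : AssumptionIII (fun z => H (z, 0)) M (limitSet (fun z => H (z, 0)) B) d₁ N α d₂)
    (hL : LipschitzWith L G) (hr : 0 ≤ r)
    (hGH : EqOn G H (Metric.cthickening δ K ×ˢ Icc (-r) r))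
    {u : ℝ → ℝ} {z : ℝ → E} (hz : IsIntegralCurveOn z (fun t x => G (x, u t)) (Ici 0))
    (hu : ∀ t, 0 ≤ t → |u t| ≤ r) (hz0 : z 0 ∈ M) {t₀ T ε : ℝ} (ht₀ : 0 ≤ t₀) (hε : 0 ≤ ε)
    (hzV : ∀ t ∈ Icc 0 t₀, z t ∈ Metric.cthickening δ K)
    (hd : Metric.infDist (z t₀) (limitSet (fun z => H (z, 0)) B) ≤ d₂)
    (huε : ∀ s ∈ Icc 0 T, |u (s + t₀)| ≤ ε)
    (hκ : L * T * Real.exp (L * T) * ε ≤ δ) {s : ℝ} (hs : s ∈ Icc 0 T) :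
    z (s + t₀) ∈ Metric.cthickening δ K ∧
    Metric.infDist (z (s + t₀)) (limitSet (fun z => H (z, 0)) B) ≤
      N * Real.exp (-α * s) * Metric.infDist (z t₀) (limitSet (fun z => H (z, 0)) B) +
        L * T * Real.exp (L * T) * ε := by
  have hT : 0 ≤ T := hs.1.trans hs.2
  have hzM : z t₀ ∈ M := hM u z t₀ ht₀
    ((hz.mono Icc_subset_Ici_self).congr_field fun t ht =>
      hGH ⟨hzV t ht, abs_le.1 (hu t ht.1)⟩) hz0
  obtain ⟨y, hy, hy0⟩ := hii.forwardComplete _ (hii.near _ hzM (hd.trans hiii.le))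
  have hyK : ∀ t, 0 ≤ t → y t ∈ K := fun t ht =>
    hii.orbit_subset ⟨y, hy, hy0 ▸ hii.near _ hzM (hd.trans hiii.le), t, ht, rfl⟩
  have hyG : IsIntegralCurveOn y (fun _ x => G (x, 0)) (Ici 0) :=
    IsIntegralCurveOn.congr_field hy fun t ht =>
      (hGH ⟨Metric.self_subset_cthickening _ (hyK t ht), by simpa using hr⟩).symm
  have hdist : dist (z (s + t₀)) (y s) ≤ L * T * Real.exp (L * T) * ε := by
    have h := dist_le_of_perturbation (u := fun t => u (t + t₀)) (δ := 0) hL hε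
      ((hz.shift ht₀).mono (Icc_subset_Ici_self : Icc 0 T ⊆ Ici 0))
      (hyG.mono Icc_subset_Ici_self) (by simp [hy0]) huε hs
    refine h.trans ?_
    have h1 : (0 + L * ε * s) * Real.exp (L * s) ≤ (0 + L * ε * T) * Real.exp (L * T) := by
      have := hs.1
      gcongr <;> exact hs.2
    linarith
  refine ⟨Metric.mem_cthickening_of_dist_le _ (y s) _ _ (hyK s hs.1) (hdist.trans hκ), ?_⟩
  have h1 := hiii.attractive y hy (hy0 ▸ hzM) (hy0 ▸ hd) s hs.1
  rw [hy0] at h1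
  have h2 := Metric.infDist_le_infDist_add_dist (s := limitSet (fun z => H (z, 0)) B)
    (x := z (s + t₀)) (y := y s)
  linarith

/-- Iteration of `infDist_le_of_forced` on intervals of length `T`, on each of which the unforced
system halves the distance to the limit set. -/
theorem infDist_le_exp_of_forced (hM : IsForcedInvariant H M)
    (hii : AssumptionII ν (fun z => H (z, 0)) M B K d₁)
    (hiii : AssumptionIII (fun z => H (z, 0)) M (limitSet (fun z => H (z, 0)) B) d₁ N α d₂)
    (hL : LipschitzWith L G) (hr : 0 ≤ r)
    (hGH : EqOn G H (Metric.cthickening δ K ×ˢ Icc (-r) r))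
    {u : ℝ → ℝ} {z : ℝ → E} (hz : IsIntegralCurveOn z (fun t x => G (x, u t)) (Ici 0))
    (hu : ∀ t, 0 ≤ t → |u t| ≤ r) (hz0 : z 0 ∈ M) {t₀ T ε β γ : ℝ} (ht₀ : 0 ≤ t₀) (hε : 0 ≤ ε)
    (hT : 0 < T) (hNT : N * Real.exp (-α * T) ≤ 1 / 2) (hγβ : γ ≤ β) (hγ : 0 < γ)
    (hγT : 3 / 4 ≤ Real.exp (-γ * T))
    (hzV : ∀ t ∈ Icc 0 t₀, z t ∈ Metric.cthickening δ K)
    (hd : Metric.infDist (z t₀) (limitSet (fun z => H (z, 0)) B) ≤ d₂)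
    (huε : ∀ s, 0 ≤ s → |u (s + t₀)| ≤ ε * Real.exp (-β * s))
    (hκ : L * T * Real.exp (L * T) * ε ≤ δ) (hκ₂ : L * T * Real.exp (L * T) * ε ≤ d₂ / 2)
    {s : ℝ} (hs : 0 ≤ s) :
    z (s + t₀) ∈ Metric.cthickening δ K ∧
    Metric.infDist (z (s + t₀)) (limitSet (fun z => H (z, 0)) B) ≤
      (N + (4 * N + 1) * (L * T * Real.exp (L * T))) * Real.exp (γ * T) * Real.exp (-γ * s) *
        (Metric.infDist (z t₀) (limitSet (fun z => H (z, 0)) B) + ε) := by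
  set A := limitSet (fun z => H (z, 0)) B with hA
  set κ : ℝ := L * T * Real.exp (L * T) with hκdef
  set ρ := Real.exp (-γ * T) with hρ
  have hκ0 : 0 ≤ κ := by positivity
  have hN : 1 ≤ N := hiii.one_le
  have hα := hiii.rate_pos
  have hρ1 : ρ ≤ 1 := Real.exp_le_one_iff.2 (by nlinarith)
  have hρpow : ∀ j : ℕ, ρ ^ j = Real.exp (-γ * (j * T)) := fun j => by
    rw [hρ, ← Real.exp_nat_mul]; ring_nf
  have step : ∀ j : ℕ, (∀ t ∈ Icc 0 (j * T + t₀), z t ∈ Metric.cthickening δ K) →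
      Metric.infDist (z (j * T + t₀)) A ≤ d₂ → ∀ σ ∈ Icc 0 T,
      z (σ + (j * T + t₀)) ∈ Metric.cthickening δ K ∧
      Metric.infDist (z (σ + (j * T + t₀))) A ≤
        N * Real.exp (-α * σ) * Metric.infDist (z (j * T + t₀)) A + κ * (ε * ρ ^ j) := by
    intro j hV hD σ hσ
    have hερ : ε * ρ ^ j ≤ ε := mul_le_of_le_one_right hε (pow_le_one₀ (by positivity) hρ1)
    refine infDist_le_of_forced hM hii hiii hL hr hGH hz hu hz0 (by positivity)
      (by positivity) hV hD (fun q hq => ?_)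
      ((mul_le_mul_of_nonneg_left hερ hκ0).trans hκ) hσ
    have hjT : 0 ≤ (j : ℝ) * T := by positivity
    have h := huε (q + j * T) (by linarith [hq.1])
    rw [add_assoc] at h
    refine h.trans ?_
    rw [hρpow]
    refine mul_le_mul_of_nonneg_left (Real.exp_le_exp.2 ?_) hε
    nlinarith [mul_nonneg (hγ.le.trans hγβ) hq.1, mul_nonneg (sub_nonneg.2 hγβ) hjT]
  have main : ∀ j : ℕ, (∀ t ∈ Icc 0 (j * T + t₀), z t ∈ Metric.cthickening δ K) ∧
      Metric.infDist (z (j * T + t₀)) A ≤ d₂ ∧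
      Metric.infDist (z (j * T + t₀)) A ≤ ρ ^ j * (Metric.infDist (z t₀) A + 4 * (κ * ε)) := by
    intro j
    induction j with
    | zero =>
      have : 0 ≤ κ * ε := by positivity
      simp only [Nat.cast_zero, zero_mul, zero_add, pow_zero, one_mul]
      exact ⟨hzV, hd, by linarith⟩
    | succ j ih =>
      obtain ⟨hV, hD, hDρ⟩ := ih
      have hstep := step j hV hD
      have e1 : ((j + 1 : ℕ) : ℝ) * T + t₀ = T + (j * T + t₀) := by push_cast; ring
      have hD0 : 0 ≤ Metric.infDist (z (j * T + t₀)) A := Metric.infDist_nonneg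
      have hlast := (hstep T ⟨hT.le, le_rfl⟩).2
      have hhalf : Metric.infDist (z (T + (j * T + t₀))) A ≤
          1 / 2 * Metric.infDist (z (j * T + t₀)) A + κ * (ε * ρ ^ j) :=
        hlast.trans (by gcongr)
      have hρj : 0 < ρ ^ j := by positivity
      have hκερ : κ * (ε * ρ ^ j) ≤ κ * ε := by
        have hερ : ε * ρ ^ j ≤ ε := mul_le_of_le_one_right hε (pow_le_one₀ (by positivity) hρ1)
        gcongr
      rw [e1]
      refine ⟨fun t ht => ?_, by linarith, hhalf.trans ?_⟩
      · rcases le_total t (j * T + t₀) with h | h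
        · exact hV t ⟨ht.1, h⟩
        · have := (hstep (t - (j * T + t₀)) ⟨by linarith, by linarith [ht.2]⟩).1
          rwa [sub_add_cancel] at this
      · -- `ρ - 1/2 ≥ 1/4` absorbs the contribution of the input
        have h0 : 0 ≤ Metric.infDist (z t₀) A := Metric.infDist_nonneg
        have h1 : 0 ≤ κ * ε := by positivity
        calc 1 / 2 * Metric.infDist (z (j * T + t₀)) A + κ * (ε * ρ ^ j)
            ≤ 1 / 2 * (ρ ^ j * (Metric.infDist (z t₀) A + 4 * (κ * ε))) + κ * (ε * ρ ^ j) := by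
              gcongr
          _ = ρ ^ j * (1 / 2 * Metric.infDist (z t₀) A + 3 / 4 * (4 * (κ * ε))) := by ring
          _ ≤ ρ ^ j * (ρ * Metric.infDist (z t₀) A + ρ * (4 * (κ * ε))) := by gcongr; linarith
          _ = ρ ^ (j + 1) * (Metric.infDist (z t₀) A + 4 * (κ * ε)) := by ring
  obtain ⟨hV, hD, hDρ⟩ := main ⌊s / T⌋₊
  set j := ⌊s / T⌋₊ with hj
  have hj1 : (j : ℝ) * T ≤ s := by
    rw [← le_div_iff₀ hT]; exact Nat.floor_le (by positivity)
  have hj2 : s ≤ j * T + T := by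
    have := (Nat.lt_floor_add_one (s / T)).le
    rw [div_le_iff₀ hT] at this
    linarith
  obtain ⟨hmem, hle⟩ := step j hV hD (s - j * T) ⟨by linarith, by linarith⟩
  have e2 : s - j * T + (j * T + t₀) = s + t₀ := by ring
  rw [e2] at hmem hle
  refine ⟨hmem, hle.trans ?_⟩
  have h0 : 0 ≤ Metric.infDist (z t₀) A := Metric.infDist_nonneg
  have h0j : 0 ≤ Metric.infDist (z (j * T + t₀)) A := Metric.infDist_nonneg
  have hexp : Real.exp (-α * (s - j * T)) ≤ 1 := Real.exp_le_one_iff.2 (by nlinarith)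
  have hρs : ρ ^ j ≤ Real.exp (γ * T) * Real.exp (-γ * s) := by
    rw [hρpow, ← Real.exp_add]
    gcongr
    nlinarith
  calc N * Real.exp (-α * (s - j * T)) * Metric.infDist (z (j * T + t₀)) A + κ * (ε * ρ ^ j)
      ≤ N * 1 * (ρ ^ j * (Metric.infDist (z t₀) A + 4 * (κ * ε))) + κ * (ε * ρ ^ j) := by
        gcongr
    _ = (N * Metric.infDist (z t₀) A + (4 * N + 1) * κ * ε) * ρ ^ j := by ring
    _ ≤ (N * Metric.infDist (z t₀) A + (4 * N + 1) * κ * ε) *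
        (Real.exp (γ * T) * Real.exp (-γ * s)) := by gcongr
    _ ≤ ((N + (4 * N + 1) * κ) * (Metric.infDist (z t₀) A + ε)) *
        (Real.exp (γ * T) * Real.exp (-γ * s)) := by
        gcongr
        have h2 : 0 ≤ (4 * N + 1) * κ * Metric.infDist (z t₀) A := by positivity
        have h3 : 0 ≤ N * ε := by positivity
        linarith
    _ = _ := by ring

variable [FiniteDimensional ℝ E]

/-- Data for the cut-off argument: a globally Lipschitz field that agrees with `H` near `K`. -/
theorem exists_cutoff (hH : ContDiff ℝ 1 H) (hK : IsCompact K) (δ r : ℝ) :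
    ∃ (G : E × ℝ → E) (L R : NNReal), LipschitzWith L G ∧ (∀ x, ‖G x‖ ≤ R) ∧
      EqOn G H (Metric.cthickening δ K ×ˢ Icc (-r) r) :=
  exists_lipschitzWith_bounded_eqOn hH
    (hK.isBounded.cthickening.prod (Metric.isBounded_Icc _ _))

theorem exists_isIntegralCurveOn_cutoff {R : NNReal} (hL : LipschitzWith L G)
    (hR : ∀ x, ‖G x‖ ≤ R) {u : ℝ → ℝ} (hu : Continuous u) (z₀ : E) :
    ∃ z : ℝ → E, z 0 = z₀ ∧ IsIntegralCurveOn z (fun t x => G (x, u t)) (Ici 0) := by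
  have : CompleteSpace E := FiniteDimensional.complete ℝ E
  refine exists_isIntegralCurveOn_Ici (L := L) (R := R) (fun t => ?_) (fun t x => hR _)
    (fun x => ?_) z₀
  · exact LipschitzWith.of_dist_le_mul fun a b => (hL.dist_le_mul _ _).trans
      (by simp [Prod.dist_eq])
  · exact hL.continuous.comp (by fun_prop)

/-- A time over which the exponential attraction halves distances. -/
theorem exists_pos_mul_exp_le (hα : 0 < α) (hN : 1 ≤ N) :
    ∃ T, 0 < T ∧ N * Real.exp (-α * T) ≤ 1 / 2 := by
  refine ⟨Real.log (2 * N) / α, div_pos (Real.log_pos (by linarith)) hα, ?_⟩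
  rw [neg_mul, mul_div_cancel₀ _ hα.ne', Real.exp_neg, Real.exp_log (by linarith)]
  rw [mul_inv, mul_comm, mul_assoc, inv_mul_cancel₀ (by linarith)]
  norm_num

/-- A decay rate slower than `β` and slow enough compared with the step length `T`. -/
theorem exists_rate {β T : ℝ} (hβ : 0 < β) (hT : 0 < T) :
    ∃ γ, 0 < γ ∧ γ ≤ β ∧ 3 / 4 ≤ Real.exp (-γ * T) := by
  refine ⟨min β (1 / (4 * T)), by positivity, min_le_left _ _, ?_⟩
  have h1 : min β (1 / (4 * T)) * T ≤ 1 / 4 := by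
    calc min β (1 / (4 * T)) * T ≤ 1 / (4 * T) * T := by gcongr; exact min_le_right _ _
      _ = 1 / 4 := by field_simp
  have := Real.add_one_le_exp (-min β (1 / (4 * T)) * T)
  linarith

/-- Local result: if the input is small and exponentially decaying, then the forced trajectories
that start near the limit set are defined for all times and converge exponentially to it. -/
theorem exists_forced_local (hH : ContDiff ℝ 1 H) (hM : IsForcedInvariant H M)
    (hii : AssumptionII ν (fun z => H (z, 0)) M B K d₁)
    (hiii : AssumptionIII (fun z => H (z, 0)) M (limitSet (fun z => H (z, 0)) B) d₁ N α d₂)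
    (hδ : 0 < δ) {β : ℝ} (hβ : 0 < β) :
    ∃ C γ ε : ℝ, 0 ≤ C ∧ 0 < γ ∧ γ ≤ β ∧ 0 < ε ∧ ∀ u : ℝ → ℝ, Continuous u → ∀ η, 0 ≤ η → η ≤ ε →
      (∀ t, 0 ≤ t → |u t| ≤ η * Real.exp (-β * t)) → ∀ z₀ ∈ M,
      Metric.infDist z₀ (limitSet (fun z => H (z, 0)) B) ≤ d₂ →
      ∃ z : ℝ → E, z 0 = z₀ ∧ IsIntegralCurveOn z (fun t x => H (x, u t)) (Ici 0) ∧
        ∀ t, 0 ≤ t → Metric.infDist (z t) (limitSet (fun z => H (z, 0)) B) ≤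
          C * Real.exp (-γ * t) *
            (Metric.infDist z₀ (limitSet (fun z => H (z, 0)) B) + η) := by
  obtain ⟨G, L, R, hL, hR, hGH⟩ := exists_cutoff hH hii.isCompact δ 1
  obtain ⟨T, hT, hNT⟩ := exists_pos_mul_exp_le hiii.rate_pos hiii.one_le
  obtain ⟨γ, hγ, hγβ, hγT⟩ := exists_rate hβ hT
  have hN := hiii.one_le
  have hd₂ := hiii.pos
  set κ : ℝ := L * T * Real.exp (L * T) with hκdef
  have hκ0 : 0 ≤ κ := by positivity
  refine ⟨(N + (4 * N + 1) * κ) * Real.exp (γ * T), γ, min 1 (min δ (d₂ / 2) / (κ + 1)),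
    by positivity, hγ, hγβ, by positivity, ?_⟩
  intro u hu η hη hηε huη z₀ hz₀ hd
  have hη1 : η ≤ 1 := hηε.trans (min_le_left _ _)
  have hκη : κ * η ≤ min δ (d₂ / 2) := by
    have h := hηε.trans (min_le_right _ _)
    rw [le_div_iff₀ (by positivity)] at h
    nlinarith
  have hu1 : ∀ t, 0 ≤ t → |u t| ≤ 1 := fun t ht => (huη t ht).trans <|
    mul_le_one₀ hη1 (Real.exp_nonneg _) (Real.exp_le_one_iff.2 (by nlinarith))
  obtain ⟨z, hz0, hz⟩ := exists_isIntegralCurveOn_cutoff hL hR hu z₀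
  have hz0V : z 0 ∈ Metric.cthickening δ K := by
    have hB := hii.near z₀ hz₀ (hd.trans hiii.le)
    obtain ⟨y, hy, hy0⟩ := hii.forwardComplete _ hB
    refine Metric.self_subset_cthickening _ (hii.orbit_subset ⟨y, hy, hy0 ▸ hB, 0, le_rfl, ?_⟩)
    rw [hy0, hz0]
  have main := fun {s : ℝ} (hs : 0 ≤ s) => infDist_le_exp_of_forced hM hii hiii hL zero_le_one hGH
    hz hu1 (hz0.symm ▸ hz₀) le_rfl hη hT hNT hγβ hγ hγT
    (fun t ht => by rwa [le_antisymm ht.2 ht.1])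
    (hz0.symm ▸ hd) (by simpa using huη) (hκη.trans (min_le_left _ _))
    (hκη.trans (min_le_right _ _)) hs
  simp only [add_zero, hz0] at main
  refine ⟨z, hz0, hz.congr_field fun t ht => hGH ⟨(main ht).1, abs_le.1 (hu1 t ht)⟩,
    fun t ht => (main ht).2⟩

/-- Semiglobal result: if the input decays fast enough, then the forced trajectories that start in
`B` are defined for all times, stay near `K`, and converge uniformly to the limit set. -/
theorem exists_forced_semiglobal (hH : ContDiff ℝ 1 H) (hM : IsForcedInvariant H M) (hBM : B ⊆ M)
    (hii : AssumptionII ν (fun z => H (z, 0)) M B K d₁)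
    (hiii : AssumptionIII (fun z => H (z, 0)) M (limitSet (fun z => H (z, 0)) B) d₁ N α d₂)
    (hδ : 0 < δ) (hr : 0 < r) :
    ∃ μ : ℝ, 0 < μ ∧ ∀ β, μ ≤ β → ∃ C γ T : ℝ, 0 < γ ∧ ∀ u : ℝ → ℝ, Continuous u →
      (∀ t, 0 ≤ t → |u t| ≤ r * Real.exp (-β * t)) → ∀ z₀ ∈ B,
      ∃ z : ℝ → E, z 0 = z₀ ∧ IsIntegralCurveOn z (fun t x => H (x, u t)) (Ici 0) ∧
        (∀ t, 0 ≤ t → z t ∈ Metric.cthickening δ K) ∧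
        ∀ t, T ≤ t → Metric.infDist (z t) (limitSet (fun z => H (z, 0)) B) ≤
          C * Real.exp (-γ * t) := by
  obtain ⟨G, L, R, hL, hR, hGH⟩ := exists_cutoff hH hii.isCompact δ r
  obtain ⟨T, hT, hNT⟩ := exists_pos_mul_exp_le hiii.rate_pos hiii.one_le
  have hN := hiii.one_le
  have hd₂ := hiii.pos
  set A := limitSet (fun z => H (z, 0)) B with hA
  set κ : ℝ := L * T * Real.exp (L * T) with hκdef
  have hκ0 : 0 ≤ κ := by positivity
  set b := min δ (d₂ / 2) with hb
  have hb0 : 0 < b := by positivity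
  -- the unforced trajectories are near the limit set from the time `S` on
  obtain ⟨S', hS'⟩ := exists_forall_infDist_limitSet_le hii.isCompact hii.orbit_subset
    (half_pos hd₂)
  set S := max S' 1 with hSdef
  have hS0 : 0 < S := lt_of_lt_of_le one_pos (le_max_right _ _)
  set Λ : ℝ := L * Real.exp (L * S) with hΛ
  have hΛ0 : 0 ≤ Λ := by positivity
  set E₁ := Real.exp (L * S) with hE₁
  have hE₁0 : 0 < E₁ := Real.exp_pos _
  -- up to the time `η` the input is only bounded, later it is smaller than `ε`
  set η := min S (b / 2 / (Λ * r * E₁ + 1)) with hη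
  have hη0 : 0 < η := by positivity
  set ε := min (b / 2 / (Λ * S + 1)) (b / (κ + 1)) with hε
  have hε0 : 0 < ε := by positivity
  have hηb : Λ * r * η * E₁ ≤ b / 2 := by
    have h : η ≤ b / 2 / (Λ * r * E₁ + 1) := min_le_right _ _
    rw [le_div_iff₀ (by positivity)] at h
    linarith
  have hεb : Λ * ε * S ≤ b / 2 := by
    have h : ε ≤ b / 2 / (Λ * S + 1) := min_le_left _ _
    rw [le_div_iff₀ (by positivity)] at h
    linarith
  have hκε : κ * ε ≤ b := by
    have h : ε ≤ b / (κ + 1) := min_le_right _ _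
    rw [le_div_iff₀ (by positivity)] at h
    linarith
  have hηS : η ≤ S := min_le_left _ _
  refine ⟨max 1 (Real.log (r / ε) / η), by positivity, fun β hβ => ?_⟩
  have hβ0 : 0 < β := lt_of_lt_of_le one_pos ((le_max_left _ _).trans hβ)
  have hrε : r * Real.exp (-β * η) ≤ ε := by
    have h := (le_max_right _ _).trans hβ
    rw [div_le_iff₀ hη0] at h
    have h2 : r / ε ≤ Real.exp (β * η) := (Real.log_le_iff_le_exp (by positivity)).1 h
    rw [div_le_iff₀ hε0] at h2
    rw [neg_mul, Real.exp_neg, ← div_eq_mul_inv, div_le_iff₀ (Real.exp_pos _)]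
    linarith
  obtain ⟨γ, hγ, hγβ, hγT⟩ := exists_rate hβ0 hT
  set C := (N + (4 * N + 1) * κ) * Real.exp (γ * T) with hC
  refine ⟨C * Real.exp (γ * S) * (d₂ + ε), γ, S, hγ, ?_⟩
  intro u hu hur z₀ hz₀
  have hur' : ∀ t, 0 ≤ t → |u t| ≤ r := fun t ht => (hur t ht).trans <|
    mul_le_of_le_one_right hr.le (Real.exp_le_one_iff.2 (by nlinarith))
  have huε : ∀ s, 0 ≤ s → ∀ t, η ≤ t → |u (s + t)| ≤ ε * Real.exp (-β * s) := by
    intro s hs t ht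
    refine (hur (s + t) (by linarith)).trans ?_
    rw [mul_add, Real.exp_add, mul_left_comm, mul_comm ε]
    gcongr
    refine le_trans (mul_le_mul_of_nonneg_left (Real.exp_le_exp.2 ?_) hr.le) hrε
    nlinarith
  obtain ⟨z, hz0, hz⟩ := exists_isIntegralCurveOn_cutoff hL hR hu z₀
  obtain ⟨y, hy, hy0⟩ := hii.forwardComplete _ hz₀
  have hyK : ∀ t, 0 ≤ t → y t ∈ K := fun t ht =>
    hii.orbit_subset ⟨y, hy, hy0 ▸ hz₀, t, ht, rfl⟩
  have hyG : IsIntegralCurveOn y (fun _ x => G (x, 0)) (Ici 0) :=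
    IsIntegralCurveOn.congr_field hy fun t ht =>
      (hGH ⟨Metric.self_subset_cthickening _ (hyK t ht), by simpa using hr.le⟩).symm
  have hd1 : ∀ t ∈ Icc 0 η, dist (z t) (y t) ≤ Λ * r * η := by
    intro t ht
    have h := dist_le_of_perturbation (δ := 0) hL hr.le
      (hz.mono (Icc_subset_Ici_self : Icc 0 η ⊆ Ici 0)) (hyG.mono Icc_subset_Ici_self)
      (by simp [hz0, hy0]) (fun t ht => hur' t ht.1) ht
    refine h.trans ?_
    have h1 : (0 + L * r * t) * Real.exp (L * t) ≤ (0 + L * r * η) * Real.exp (L * S) := by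
      have := ht.1
      gcongr
      · exact ht.2
      · exact ht.2.trans hηS
    refine h1.trans (le_of_eq ?_)
    rw [hΛ]; ring
  have hd2 : ∀ t ∈ Icc η S, dist (z t) (y t) ≤ b := by
    intro t ht
    have h := dist_le_of_perturbation (u := fun t => u (t + η)) hL hε0.le
      ((hz.shift hη0.le).mono (Icc_subset_Ici_self : Icc 0 (S - η) ⊆ Ici 0))
      ((hyG.shift hη0.le).mono Icc_subset_Ici_self)
      (by simpa using hd1 η ⟨hη0.le, le_rfl⟩) (fun t ht => by
        refine (huε t ht.1 η le_rfl).trans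
          (mul_le_of_le_one_right hε0.le (Real.exp_le_one_iff.2 ?_))
        nlinarith [ht.1]) (t := t - η) ⟨by linarith [ht.1], by linarith [ht.2]⟩
    simp only [sub_add_cancel] at h
    refine h.trans ?_
    have ht0 : 0 ≤ t - η := by linarith [ht.1]
    have htS : t - η ≤ S := by linarith [ht.2]
    calc (Λ * r * η + L * ε * (t - η)) * Real.exp (L * (t - η))
        ≤ (Λ * r * η + L * ε * S) * Real.exp (L * S) := by gcongr
      _ = Λ * r * η * E₁ + Λ * ε * S := by rw [hΛ]; ring
      _ ≤ b := by linarith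
  have hd3 : ∀ t ∈ Icc 0 S, dist (z t) (y t) ≤ b := by
    intro t ht
    rcases le_total t η with h | h
    · have h1 := hd1 t ⟨ht.1, h⟩
      have h2 : 1 ≤ E₁ := Real.one_le_exp (by positivity)
      have h3 : 0 ≤ Λ * r * η := by positivity
      nlinarith
    · exact hd2 t ⟨h, ht.2⟩
  have hzV : ∀ t ∈ Icc 0 S, z t ∈ Metric.cthickening δ K := fun t ht =>
    Metric.mem_cthickening_of_dist_le _ (y t) _ _ (hyK t ht.1)
      ((hd3 t ht).trans (min_le_left _ _))
  have hzS : Metric.infDist (z S) A ≤ d₂ := by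
    have h1 := hS' y hy (hy0 ▸ hz₀) S (le_max_left _ _)
    have h2 := Metric.infDist_le_infDist_add_dist (s := A) (x := z S) (y := y S)
    have h3 := (hd3 S ⟨hS0.le, le_rfl⟩).trans (min_le_right _ _)
    linarith
  have main := fun {s : ℝ} (hs : 0 ≤ s) => infDist_le_exp_of_forced hM hii hiii hL hr.le hGH
    hz hur' (hz0.symm ▸ hBM hz₀) hS0.le hε0.le hT hNT hγβ hγ hγT hzV hzS
    (fun s hs => huε s hs S hηS) (hκε.trans (min_le_left _ _)) (hκε.trans (min_le_right _ _)) hs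
  have hV : ∀ t, 0 ≤ t → z t ∈ Metric.cthickening δ K := by
    intro t ht
    rcases le_total t S with h | h
    · exact hzV t ⟨ht, h⟩
    · simpa using (main (sub_nonneg.2 h)).1
  refine ⟨z, hz0, hz.congr_field fun t ht => hGH ⟨hV t ht, abs_le.1 (hur' t ht)⟩, hV,
    fun t ht => ?_⟩
  have h := (main (sub_nonneg.2 ht)).2
  rw [sub_add_cancel] at h
  refine h.trans ?_
  have e1 : Real.exp (-γ * (t - S)) = Real.exp (γ * S) * Real.exp (-γ * t) := by
    rw [← Real.exp_add]; ring_nf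
  rw [e1]
  calc C * (Real.exp (γ * S) * Real.exp (-γ * t)) * (Metric.infDist (z S) A + ε)
      ≤ C * (Real.exp (γ * S) * Real.exp (-γ * t)) * (d₂ + ε) := by gcongr
    _ = _ := by ring

end

/-! ### Exponential decay of Hurwitz linear systems -/

section

variable {V : Type*} [NormedAddCommGroup V] [NormedSpace ℂ V] [FiniteDimensional ℂ V]

theorem exp_apply_of_eigenvector {Λ : V →L[ℂ] V} {z : ℂ} {v : V} (h : Λ v = z • v) :
    NormedSpace.exp Λ v = Complex.exp z • v := by
  have : CompleteSpace V := FiniteDimensional.complete ℂ V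
  have hpow : ∀ n : ℕ, (Λ ^ n) v = z ^ n • v := by
    intro n
    induction n with
    | zero => simp
    | succ n ih => rw [pow_succ', mul_apply_eq_comp, ih, map_smul, h, smul_smul, pow_succ]
  have h1 := (NormedSpace.exp_series_hasSum_exp' (𝕂 := ℂ) Λ).mapL
    (ContinuousLinearMap.apply ℂ V v)
  have h2 := (NormedSpace.exp_series_hasSum_exp' (𝕂 := ℂ) z).mapL
    ((ContinuousLinearMap.id ℂ ℂ).smulRight v)
  simp only [ContinuousLinearMap.apply_apply, smul_apply, hpow,
    ContinuousLinearMap.smulRight_apply, ContinuousLinearMap.id_apply, smul_eq_mul] at h1 h2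
  simp only [← smul_smul] at h2
  rw [Complex.exp_eq_exp_ℂ]
  exact h1.unique h2

/-- If all the eigenvalues of `Λ` have negative real part, then the spectral radius of `exp Λ` is
smaller than one: an eigenspace of `exp Λ` is stable under `Λ`, hence it contains an eigenvector
of `Λ`. -/
theorem spectralRadius_exp_lt_one [Nontrivial V] {Λ : V →L[ℂ] V}
    (h : ∀ (z : ℂ) (v : V), v ≠ 0 → Λ v = z • v → z.re < 0) :
    spectralRadius ℂ (NormedSpace.exp Λ) < 1 := by
  have : CompleteSpace V := FiniteDimensional.complete ℂ V
  refine spectrum.spectralRadius_lt_of_forall_lt (r := 1) (NormedSpace.exp Λ) fun μ hμ => ?_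
  set T : V →L[ℂ] V := NormedSpace.exp Λ with hT
  let W : Submodule ℂ V := Module.End.eigenspace (T : V →ₗ[ℂ] V) μ
  have hW : W ≠ ⊥ := by
    intro hbot
    refine hμ (ContinuousLinearMap.isUnit_iff_bijective.2 ?_)
    have hinj : Function.Injective ((algebraMap ℂ (V →L[ℂ] V) μ - T : V →L[ℂ] V) : V →ₗ[ℂ] V) := by
      rw [← LinearMap.ker_eq_bot, LinearMap.ker_eq_bot']
      intro v hv
      have : v ∈ W := by
        rw [Module.End.mem_eigenspace_iff]
        have hv' : μ • v - T v = 0 := by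
          simpa [Algebra.algebraMap_eq_smul_one] using hv
        exact (sub_eq_zero.1 hv').symm
      rw [hbot] at this
      simpa using this
    exact ⟨hinj, LinearMap.injective_iff_surjective.1 hinj⟩
  have hcomm : Commute Λ T := (Commute.refl Λ).exp_right
  have hstab : ∀ v ∈ W, (Λ : V →ₗ[ℂ] V) v ∈ W := by
    intro v hv
    rw [Module.End.mem_eigenspace_iff] at hv ⊢
    have h1 : T (Λ v) = Λ (T v) := (DFunLike.congr_fun hcomm.eq v).symm
    change T v = μ • v at hv
    change T (Λ v) = μ • Λ v
    rw [h1, hv, map_smul]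
  have : Nontrivial W := Submodule.nontrivial_iff_ne_bot.2 hW
  obtain ⟨z, hz⟩ := Module.End.exists_eigenvalue ((Λ : V →ₗ[ℂ] V).restrict hstab)
  obtain ⟨w, hw⟩ := hz.exists_hasEigenvector
  have hw0 : (w : V) ≠ 0 := fun h0 => hw.2 (Subtype.ext h0)
  have hΛw : Λ (w : V) = z • (w : V) := congrArg Subtype.val hw.apply_eq_smul
  have hTw : T (w : V) = μ • (w : V) := Module.End.mem_eigenspace_iff.1 w.2
  rw [hT, exp_apply_of_eigenvector hΛw] at hTw
  have hμz : Complex.exp z = μ := smul_left_injective ℂ hw0 hTw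
  have hlt : ‖μ‖ < 1 := by
    rw [← hμz, Complex.norm_exp]
    exact Real.exp_lt_one_iff.2 (h z w hw0 hΛw)
  exact_mod_cast hlt

theorem exists_norm_exp_smul_le [Nontrivial V] {Λ : V →L[ℂ] V}
    (h : ∀ (z : ℂ) (v : V), v ≠ 0 → Λ v = z • v → z.re < 0) :
    ∃ C l : ℝ, 0 < C ∧ 0 < l ∧ ∀ t : ℝ, 0 ≤ t →
      ‖NormedSpace.exp (t • Λ)‖ ≤ C * Real.exp (-l * t) := by
  have : CompleteSpace V := FiniteDimensional.complete ℂ V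
  set T : V →L[ℂ] V := NormedSpace.exp Λ with hT
  obtain ⟨n, hn, hn0⟩ := (((spectrum.pow_nnnorm_pow_one_div_tendsto_nhds_spectralRadius T).eventually
    (gt_mem_nhds (spectralRadius_exp_lt_one h))).and (eventually_gt_atTop 0)).exists
  have hTn : ‖T ^ n‖ < 1 := by
    by_contra! hge
    have h1 : (1 : ENNReal) ≤ (‖T ^ n‖₊ : ENNReal) := by exact_mod_cast hge
    exact absurd (ENNReal.one_le_rpow h1 (by positivity)) (not_le.2 hn)
  have hn' : (0 : ℝ) < n := by exact_mod_cast hn0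
  set q := max ‖T ^ n‖ (1 / 2) with hq
  have hq0 : 0 < q := lt_of_lt_of_le (by norm_num) (le_max_right _ _)
  have hq1 : q < 1 := max_lt hTn (by norm_num)
  set l := -Real.log q / n with hl
  have hl0 : 0 < l := div_pos (neg_pos.2 (Real.log_neg hq0 hq1)) hn'
  have hqexp : q = Real.exp (-l * n) := by
    rw [hl, neg_mul, div_mul_cancel₀ _ hn'.ne', neg_neg, Real.exp_log hq0]
  have hcont : Continuous fun s : ℝ => NormedSpace.exp (s • Λ) :=
    continuous_iff_continuousAt.2 fun s => (hasDerivAt_exp_smul_const Λ s).continuousAt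
  obtain ⟨D, hD⟩ := (isCompact_Icc (a := (0 : ℝ)) (b := n)).exists_bound_of_continuousOn
    hcont.continuousOn
  have hD0 : 0 ≤ D := (norm_nonneg _).trans (hD 0 ⟨le_rfl, hn'.le⟩)
  refine ⟨(D + 1) * Real.exp (l * n), l, by positivity, hl0, fun t ht => ?_⟩
  set j := ⌊t / n⌋₊ with hj
  have hj1 : (j : ℝ) * n ≤ t := by
    rw [← le_div_iff₀ hn']; exact Nat.floor_le (by positivity)
  have hj2 : t ≤ j * n + n := by
    have := (Nat.lt_floor_add_one (t / n)).le
    rw [div_le_iff₀ hn'] at this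
    linarith
  have e1 : t • Λ = (j * n) • Λ + (t - j * n) • Λ := by
    rw [← Nat.cast_smul_eq_nsmul ℝ, ← add_smul]; push_cast; ring_nf
  have hcomm : Commute ((j * n) • Λ) ((t - j * n) • Λ) :=
    ((Commute.refl Λ).smul_left _).smul_right _
  let : NormedAlgebra ℚ (V →L[ℂ] V) := NormedAlgebra.restrictScalars ℚ ℂ _
  rw [e1, NormedSpace.exp_add_of_commute hcomm, NormedSpace.exp_nsmul, mul_comm j n, pow_mul]
  have h1 : ‖(T ^ n) ^ j‖ ≤ q ^ j := by
    refine (norm_pow_le _ _).trans ?_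
    gcongr
    exact le_max_left _ _
  have h2 : q ^ j ≤ Real.exp (l * n) * Real.exp (-l * t) := by
    rw [hqexp, ← Real.exp_nat_mul, ← Real.exp_add]
    gcongr
    nlinarith
  calc ‖(T ^ n) ^ j * NormedSpace.exp ((t - j * n) • Λ)‖
      ≤ ‖(T ^ n) ^ j‖ * ‖NormedSpace.exp ((t - j * n) • Λ)‖ := norm_mul_le _ _
    _ ≤ (Real.exp (l * n) * Real.exp (-l * t)) * (D + 1) := by
        gcongr
        · exact h1.trans h2
        · exact (hD _ ⟨by linarith, by linarith⟩).trans (by linarith)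
    _ = _ := by ring

theorem IsIntegralCurveOn.eq_exp_apply {Λ : V →L[ℂ] V} {y : ℝ → V} {c : ℝ}
    (hy : IsIntegralCurveOn y (fun _ v => c • Λ v) (Ici 0)) {t : ℝ} (ht : 0 ≤ t) :
    y t = NormedSpace.exp ((c * t) • Λ) (y 0) := by
  have : CompleteSpace V := FiniteDimensional.complete ℂ V
  have hlip : LipschitzWith ‖c • Λ‖₊ (fun v => c • Λ v) := (c • Λ).lipschitz
  have hexp : IsIntegralCurveOn (fun t : ℝ => NormedSpace.exp ((c * t) • Λ) (y 0))
      (fun _ v => c • Λ v) (Ici 0) := by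
    intro s _
    have h1 := (hasDerivAt_exp_smul_const' (𝕂 := ℝ) Λ (c * s)).scomp s
      ((hasDerivAt_id s).const_mul c)
    have h2 := ((ContinuousLinearMap.apply ℂ V (y 0)).restrictScalars ℝ).hasFDerivAt.comp_hasDerivAt
      s h1
    simpa [Function.comp_def] using h2.hasDerivWithinAt
  exact IsIntegralCurveOn.eqOn_Icc (v := fun _ v => c • Λ v) (fun _ => hlip)
    (hy.mono (Icc_subset_Ici_self : Icc 0 t ⊆ Ici 0)) (hexp.mono Icc_subset_Ici_self) (by simp)
    ⟨ht, le_rfl⟩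

end

/-! ### The error dynamics -/

section

variable {m : ℕ}

/-- The companion matrix of `λᵐ + a_{m-1} λ^{m-1} + … + a₀`, as an operator of `ℂᵐ`. -/
noncomputable def companionMap (a : Fin m → ℝ) : (Fin m → ℂ) →L[ℂ] (Fin m → ℂ) :=
  LinearMap.toContinuousLinearMap
    { toFun := fun v j => if h : (j : ℕ) + 1 < m then v ⟨(j : ℕ) + 1, h⟩ else -∑ i, (a i : ℂ) * v i
      map_add' := fun v w => by
        ext j
        by_cases h : (j : ℕ) + 1 < m
        · simp [h]
        · simp [h, mul_add, Finset.sum_add_distrib, add_comm]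
      map_smul' := fun z v => by
        ext j
        by_cases h : (j : ℕ) + 1 < m
        · simp [h]
        · simp [h, Finset.mul_sum, mul_left_comm] }

theorem companionMap_apply (a : Fin m → ℝ) (v : Fin m → ℂ) (j : Fin m) :
    companionMap a v j =
      if h : (j : ℕ) + 1 < m then v ⟨(j : ℕ) + 1, h⟩ else -∑ i, (a i : ℂ) * v i := rfl

theorem re_neg_of_companionMap_eigenvector [NeZero m] {a : Fin m → ℝ} (ha : IsHurwitz a) (z : ℂ)
    (v : Fin m → ℂ) (hv : v ≠ 0) (h : companionMap a v = z • v) : z.re < 0 := by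
  have hj : ∀ j : Fin m, companionMap a v j = z * v j := fun j => by rw [h]; rfl
  have hpow : ∀ (k : ℕ) (hk : k < m), v ⟨k, hk⟩ = z ^ k * v 0 := by
    intro k
    induction k with
    | zero => intro hk; simp
    | succ k ih =>
      intro hk
      have h1 := hj ⟨k, by omega⟩
      rw [companionMap_apply, dif_pos hk, ih] at h1
      rw [h1]; ring
  have hm := NeZero.pos m
  have hv0 : v 0 ≠ 0 := fun h0 => hv (funext fun j => by
    rw [← Fin.eta j j.2, hpow]; simp [h0])
  have hlast := hj ⟨m - 1, by omega⟩
  rw [companionMap_apply, dif_neg (by simp; omega), hpow] at hlast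
  refine ha z (mul_right_cancel₀ hv0 ?_)
  have e1 : z ^ m = z * z ^ (m - 1) := by rw [← pow_succ']; congr 1; omega
  have e2 : ∑ i, (a i : ℂ) * v i = (∑ i : Fin m, (a i : ℂ) * z ^ (i : ℕ)) * v 0 := by
    rw [Finset.sum_mul]
    refine Finset.sum_congr rfl fun i _ => ?_
    rw [← Fin.eta i i.2, hpow]; ring
  rw [zero_mul, add_mul, ← e2, e1]
  linear_combination -hlast

theorem isLinearMap_errorField (g : ℝ) (a : Fin m → ℝ) : IsLinearMap ℝ (Plant.errorField g a) where
  map_add := fun v w => by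
    ext j
    by_cases h : (j : ℕ) + 1 < m
    · simp [Plant.errorField, h]
    · simp [Plant.errorField, Plant.gainSum, h, mul_add, Finset.sum_add_distrib, add_comm]
  map_smul := fun z v => by
    ext j
    by_cases h : (j : ℕ) + 1 < m
    · simp [Plant.errorField, h]
    · simp [Plant.errorField, Plant.gainSum, h, Finset.mul_sum, mul_left_comm]

/-- `errorField`, as a continuous linear map. -/
noncomputable def errorMap (g : ℝ) (a : Fin m → ℝ) : Euc m →L[ℝ] Euc m :=
  LinearMap.toContinuousLinearMap (isLinearMap_errorField g a).mk'

theorem exists_isForwardSolution_errorField (g : ℝ) (a : Fin m → ℝ) (e₀ : Euc m) :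
    ∃ e : ℝ → Euc m, Continuous e ∧ IsForwardSolution (Plant.errorField g a) e ∧ e 0 = e₀ := by
  have hd : ∀ t : ℝ, HasDerivAt (fun t : ℝ => NormedSpace.exp (t • errorMap g a) e₀)
      (Plant.errorField g a (NormedSpace.exp (t • errorMap g a) e₀)) t := fun t =>
    (ContinuousLinearMap.apply ℝ (Euc m) e₀).hasFDerivAt.comp_hasDerivAt t
      (hasDerivAt_exp_smul_const' (errorMap g a) t)
  exact ⟨fun t => NormedSpace.exp (t • errorMap g a) e₀, continuous_iff_continuousAt.2 fun t => (hd t).continuousAt,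
    fun t _ => (hd t).hasDerivWithinAt, by
      beta_reduce
      rw [zero_smul ℝ (errorMap g a), NormedSpace.exp_zero, one_apply_eq_self]⟩

/-- In the scaled coordinates `g⁻ⁱ eᵢ₊₁` the error dynamics are `g` times those of gain one. Hence
the error decays at a rate proportional to `g`, and its first component, which the scaling leaves
unchanged, does so without peaking. -/
theorem exists_error_le [NeZero m] {a : Fin m → ℝ} (ha : IsHurwitz a) :
    ∃ C l : ℝ, 0 < C ∧ 0 < l ∧ ∀ g : ℝ, 1 ≤ g → ∀ e : ℝ → Euc m,
      IsForwardSolution (Plant.errorField g a) e → ∀ t, 0 ≤ t →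
        |e t 0| ≤ C * ‖e 0‖ * Real.exp (-(l * g) * t) ∧
        ‖e t‖ ≤ m * g ^ m * (C * ‖e 0‖ * Real.exp (-(l * g) * t)) := by
  obtain ⟨C, l, hC, hl, hexp⟩ := exists_norm_exp_smul_le (re_neg_of_companionMap_eigenvector ha)
  refine ⟨C, l, hC, hl, fun g hg e he t ht => ?_⟩
  have hg0 : 0 < g := by linarith
  let y : ℝ → Fin m → ℂ := fun t j => ((e t j / g ^ (j : ℕ) : ℝ) : ℂ)
  have hy : IsIntegralCurveOn y (fun _ v => g • companionMap a v) (Ici 0) := by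
    intro s hs
    rw [hasDerivWithinAt_pi]
    intro j
    have h1 := (EuclideanSpace.proj (𝕜 := ℝ) j).hasFDerivAt.comp_hasDerivWithinAt s (he s hs)
    have h2 := (h1.div_const (g ^ (j : ℕ))).ofReal_comp
    refine h2.congr_deriv ?_
    change ((Plant.errorField g a (e s) j / g ^ (j : ℕ) : ℝ) : ℂ) = _
    simp only [Plant.errorField, Pi.smul_apply, companionMap_apply, y]
    by_cases h : (j : ℕ) + 1 < m
    · simp only [h, dif_pos, Complex.real_smul, ← Complex.ofReal_mul]
      congr 1
      rw [pow_succ]; field_simp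
    · have hjm : (j : ℕ) + 1 = m := by omega
      simp only [h, dif_neg, not_false_iff, Complex.real_smul, ← Complex.ofReal_mul,
        ← Complex.ofReal_sum, ← Complex.ofReal_neg, Plant.gainSum]
      congr 1
      rw [mul_neg, neg_div, Finset.sum_div, Finset.mul_sum]
      congr 1
      refine Finset.sum_congr rfl fun i _ => ?_
      have e1 : g ^ (m - (i : ℕ)) * g ^ (i : ℕ) = g * g ^ (j : ℕ) := by
        rw [← pow_add, ← pow_succ']; congr 1; omega
      rw [div_eq_iff (by positivity)]
      have e2 : g ^ (m - (i : ℕ)) = g * g ^ (j : ℕ) / g ^ (i : ℕ) := by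
        rw [eq_div_iff (by positivity), e1]
      rw [e2]; ring
  have hy0 : ‖y 0‖ ≤ ‖e 0‖ := by
    refine (pi_norm_le_iff_of_nonneg (norm_nonneg _)).2 fun j => ?_
    simp only [y, Complex.norm_real, norm_div]
    refine (div_le_self (norm_nonneg _) ?_).trans (PiLp.norm_apply_le (e 0) j)
    rw [norm_pow, Real.norm_of_nonneg hg0.le]
    exact one_le_pow₀ hg
  have hyt : ‖y t‖ ≤ C * ‖e 0‖ * Real.exp (-(l * g) * t) := by
    rw [hy.eq_exp_apply ht]
    refine (ContinuousLinearMap.le_opNorm _ _).trans ?_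
    calc ‖NormedSpace.exp ((g * t) • companionMap a)‖ * ‖y 0‖
        ≤ (C * Real.exp (-l * (g * t))) * ‖e 0‖ := by
          gcongr
          exact hexp _ (by positivity)
      _ = _ := by rw [show -l * (g * t) = -(l * g) * t by ring]; ring
  have hcomp : ∀ j : Fin m, |e t j| ≤ g ^ (j : ℕ) * ‖y t‖ := by
    intro j
    have h1 := norm_le_pi_norm (y t) j
    simp only [y, Complex.norm_real, norm_div, Real.norm_eq_abs] at h1
    rw [abs_of_pos (by positivity : 0 < g ^ (j : ℕ)), div_le_iff₀ (by positivity)] at h1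
    linarith
  constructor
  · have h1 := hcomp 0
    simp only [Fin.val_zero, pow_zero, one_mul] at h1
    exact h1.trans hyt
  · have h1 : ‖e t‖ ≤ ∑ j : Fin m, |e t j| := by
      have := norm_sum_le Finset.univ fun j => EuclideanSpace.single j (e t j)
      simp only [PiLp.norm_single, Real.norm_eq_abs] at this
      refine le_trans (le_of_eq ?_) this
      congr 1
      ext i
      simp [Finset.sum_apply]
    refine h1.trans ?_
    calc ∑ j : Fin m, |e t j| ≤ ∑ j : Fin m, g ^ m * (C * ‖e 0‖ * Real.exp (-(l * g) * t)) := by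
          refine Finset.sum_le_sum fun j _ => (hcomp j).trans ?_
          gcongr
          exact j.2.le
      _ = _ := by simp; ring

end

/-! ### Euclidean products -/

section

theorem prodSet_zero_nonempty {X Y : Type*} [Zero Y] {A : Set X} (hA : A.Nonempty) :
    (prodSet A ({0} : Set Y)).Nonempty := by
  obtain ⟨b, hb⟩ := hA
  exact ⟨WithLp.toLp 2 (b, 0), hb, rfl⟩

variable {X Y : Type*} [NormedAddCommGroup X] [NormedAddCommGroup Y]

theorem infDist_fst_le_infDist_prodSet {A : Set X} (hA : A.Nonempty) (x : WithLp 2 (X × Y)) :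
    Metric.infDist x.fst A ≤ Metric.infDist x (prodSet A {0}) := by
  exact (Metric.le_infDist (prodSet_zero_nonempty hA)).2 fun y hy =>
    (Metric.infDist_le_dist_of_mem hy.1).trans (WithLp.dist_fst_le x y)

theorem norm_snd_le_infDist_prodSet {A : Set X} (hA : A.Nonempty) (x : WithLp 2 (X × Y)) :
    ‖x.snd‖ ≤ Metric.infDist x (prodSet A {0}) := by
  refine (Metric.le_infDist (prodSet_zero_nonempty hA)).2 fun y hy => ?_
  have h1 := WithLp.dist_snd_le x y
  rwa [show y.snd = 0 from hy.2, dist_zero_right] at h1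

theorem infDist_prodSet_le {A : Set X} (hA : A.Nonempty) (x : WithLp 2 (X × Y)) :
    Metric.infDist x (prodSet A {0}) ≤ Metric.infDist x.fst A + ‖x.snd‖ := by
  refine le_of_forall_pos_lt_add fun ε hε => ?_
  obtain ⟨b, hb, hlt⟩ :=
    (Metric.infDist_lt_iff hA).1 (lt_add_of_pos_right (Metric.infDist x.fst A) hε)
  have h1 : Metric.infDist x (prodSet A {0}) ≤ dist x (WithLp.toLp 2 (b, 0)) :=
    Metric.infDist_le_dist_of_mem ⟨hb, rfl⟩
  have h2 : dist x (WithLp.toLp 2 (b, 0)) ≤ dist x.fst b + ‖x.snd‖ := by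
    rw [dist_eq_norm, dist_eq_norm]
    have e1 : x - WithLp.toLp 2 (b, 0) =
        WithLp.toLp 2 (x.fst - b, (0 : Y)) + WithLp.toLp 2 ((0 : X), x.snd) := by
      apply (WithLp.equiv 2 (X × Y)).injective
      ext <;> simp
    rw [e1]
    refine (norm_add_le _ _).trans ?_
    rw [WithLp.norm_toLp_fst, WithLp.norm_toLp_snd]
  linarith

end

section

variable {X Y : Type*} [NormedAddCommGroup X] [NormedSpace ℝ X] [NormedAddCommGroup Y]
  [NormedSpace ℝ Y]

theorem IsIntegralCurveOn.withLp_fst {x : ℝ → WithLp 2 (X × Y)}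
    {v : ℝ → WithLp 2 (X × Y) → WithLp 2 (X × Y)} {s : Set ℝ} (hx : IsIntegralCurveOn x v s)
    {t : ℝ} (ht : t ∈ s) : HasDerivWithinAt (fun t => (x t).fst) (v t (x t)).fst s t :=
  (WithLp.fstL 2 ℝ X Y).hasFDerivAt.comp_hasDerivWithinAt t (hx t ht)

theorem IsIntegralCurveOn.withLp_snd {x : ℝ → WithLp 2 (X × Y)}
    {v : ℝ → WithLp 2 (X × Y) → WithLp 2 (X × Y)} {s : Set ℝ} (hx : IsIntegralCurveOn x v s)
    {t : ℝ} (ht : t ∈ s) : HasDerivWithinAt (fun t => (x t).snd) (v t (x t)).snd s t :=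
  (WithLp.sndL 2 ℝ X Y).hasFDerivAt.comp_hasDerivWithinAt t (hx t ht)

theorem HasDerivWithinAt.withLp_toLp {x : ℝ → X} {y : ℝ → Y} {x' : X} {y' : Y} {s : Set ℝ} {t : ℝ}
    (hx : HasDerivWithinAt x x' s t) (hy : HasDerivWithinAt y y' s t) :
    HasDerivWithinAt (fun t => WithLp.toLp 2 (x t, y t)) (WithLp.toLp 2 (x', y')) s t :=
  (WithLp.prodContinuousLinearEquiv 2 ℝ X Y).symm.hasFDerivAt.comp_hasDerivWithinAt t
    (hx.prodMk hy)

theorem contDiff_withLp_fst {n : WithTop ℕ∞} :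
    ContDiff ℝ n (fun x : WithLp 2 (X × Y) => x.fst) := (WithLp.fstL 2 ℝ X Y).contDiff

theorem contDiff_withLp_snd {n : WithTop ℕ∞} :
    ContDiff ℝ n (fun x : WithLp 2 (X × Y) => x.snd) := (WithLp.sndL 2 ℝ X Y).contDiff

theorem fderiv_comp_withLp_fst {V : Type*} [NormedAddCommGroup V] [NormedSpace ℝ V] {f : X → V}
    {x : WithLp 2 (X × Y)} (hf : DifferentiableAt ℝ f x.fst) (v : WithLp 2 (X × Y)) :
    fderiv ℝ (fun x : WithLp 2 (X × Y) => f x.fst) x v = fderiv ℝ f x.fst v.fst := by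
  have h1 : HasFDerivAt (fun x : WithLp 2 (X × Y) => f x.fst)
      ((fderiv ℝ f x.fst).comp (WithLp.fstL 2 ℝ X Y)) x :=
    hf.hasFDerivAt.comp x (WithLp.fstL 2 ℝ X Y).hasFDerivAt
  rw [h1.fderiv]
  rfl

theorem ContDiff.withLp_toLp {V : Type*} [NormedAddCommGroup V] [NormedSpace ℝ V]
    {n : WithTop ℕ∞} {f : V → X} {h : V → Y} (hf : ContDiff ℝ n f) (hh : ContDiff ℝ n h) :
    ContDiff ℝ n (fun x => WithLp.toLp 2 (f x, h x)) :=
  (WithLp.prodContinuousLinearEquiv 2 ℝ X Y).symm.contDiff.comp (hf.prodMk hh)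

theorem ContDiffOn.withLp_toLp {V : Type*} [NormedAddCommGroup V] [NormedSpace ℝ V]
    {n : WithTop ℕ∞} {f : V → X} {h : V → Y} {s : Set V} (hf : ContDiffOn ℝ n f s)
    (hh : ContDiffOn ℝ n h s) : ContDiffOn ℝ n (fun x => WithLp.toLp 2 (f x, h x)) s :=
  (WithLp.prodContinuousLinearEquiv 2 ℝ X Y).symm.contDiff.comp_contDiffOn (hf.prodMk hh)

/-- If `A` is a submanifold with boundary, then so is `A × {0}`: the charts are the products of
those of `A` with the identity. -/
theorem isSubmanifoldWithBoundary_prodSet_zero {ν : ℕ∞} {A : Set X}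
    (hA : IsSubmanifoldWithBoundary ν A) :
    IsSubmanifoldWithBoundary ν (prodSet A ({0} : Set Y)) := by
  obtain ⟨k, hk⟩ := hA
  refine ⟨k, fun x hx => ?_⟩
  obtain ⟨Φ, L, ℓ, hL, hxs, hΦ, hΦs, himg⟩ := hk x.fst hx.1
  let e : WithLp 2 (X × Y) ≃ₜ X × Y := (WithLp.prodContinuousLinearEquiv 2 ℝ X Y).toHomeomorph
  let Ψ : OpenPartialHomeomorph (WithLp 2 (X × Y)) (WithLp 2 (X × Y)) :=
    (e.transOpenPartialHomeomorph (Φ.prod (OpenPartialHomeomorph.refl Y))).transHomeomorph e.symm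
  let ι : X →ₗ[ℝ] WithLp 2 (X × Y) :=
    (WithLp.prodContinuousLinearEquiv 2 ℝ X Y).symm.toLinearMap ∘ₗ LinearMap.inl ℝ X Y
  have hι : Function.Injective ι := fun v w h => congrArg WithLp.fst h
  have hsrc : ∀ y, y ∈ Ψ.source ↔ y.fst ∈ Φ.source := fun y => by
    simp [Ψ, e]
  have htgt : ∀ y, y ∈ Ψ.target ↔ y.fst ∈ Φ.target := fun y => by
    simp [Ψ, e]
  have happ : ∀ y, Ψ y = WithLp.toLp 2 (Φ y.fst, y.snd) := fun y => rfl
  have hsymm : ∀ y, Ψ.symm y = WithLp.toLp 2 (Φ.symm y.fst, y.snd) := fun y => rfl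
  have hmapL : ∀ y, y ∈ L.map ι ↔ y.fst ∈ L ∧ y.snd = 0 := by
    intro y
    constructor
    · rintro ⟨v, hv, rfl⟩
      exact ⟨hv, rfl⟩
    · rintro ⟨h1, h2⟩
      refine ⟨y.fst, h1, ?_⟩
      change WithLp.toLp 2 (y.fst, (0 : Y)) = y
      rw [← h2]
      rfl
  refine ⟨Ψ, L.map ι, ℓ.comp (WithLp.fstL 2 ℝ X Y), ?_, (hsrc x).2 hxs, ?_, ?_, ?_⟩
  · rw [← hL]
    exact (Submodule.equivMapOfInjective ι hι L).finrank_eq.symm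
  · have h1 : ContDiffOn ℝ ν (fun y : WithLp 2 (X × Y) => Φ y.fst) Ψ.source :=
      hΦ.comp contDiff_withLp_fst.contDiffOn fun y hy => (hsrc y).1 hy
    exact h1.withLp_toLp contDiff_withLp_snd.contDiffOn
  · have h1 : ContDiffOn ℝ ν (fun y : WithLp 2 (X × Y) => Φ.symm y.fst) Ψ.target :=
      hΦs.comp contDiff_withLp_fst.contDiffOn fun y hy => (htgt y).1 hy
    exact h1.withLp_toLp contDiff_withLp_snd.contDiffOn
  · ext y
    constructor
    · rintro ⟨b, ⟨hbA, hbs⟩, rfl⟩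
      have hb := (hsrc b).1 hbs
      have hm : Φ b.fst ∈ {y | y ∈ L ∧ 0 ≤ ℓ y} ∩ Φ.target := himg ▸ ⟨b.fst, ⟨hbA.1, hb⟩, rfl⟩
      exact ⟨⟨(hmapL _).2 ⟨hm.1.1, hbA.2⟩, hm.1.2⟩, (htgt _).2 hm.2⟩
    · rintro ⟨⟨hyL, hyℓ⟩, hyt⟩
      have hyL' := (hmapL y).1 hyL
      have hm : y.fst ∈ Φ '' (A ∩ Φ.source) := himg ▸ ⟨⟨hyL'.1, hyℓ⟩, (htgt y).1 hyt⟩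
      obtain ⟨b, hb, hby⟩ := hm
      refine ⟨WithLp.toLp 2 (b, 0), ⟨⟨hb.1, rfl⟩, (hsrc _).2 hb.2⟩, ?_⟩
      rw [happ]
      change WithLp.toLp 2 (Φ b, (0 : Y)) = y
      rw [hby, ← hyL'.2]
      rfl

end

/-! ### The zero dynamics of the transformed plant -/

namespace OutputRegulation.Plant

variable {p s n m : ℕ}

/-- The zero dynamics of the plant, forced by the first component `e₁` of the error:
`𝐰̇ = 𝐬(𝐰)`, `ż = f₀(ϱ,w,z) + f₁(ϱ,w,z,e₁) e₁`, as a function of `(𝐳, e₁)`. -/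
noncomputable def forcedField (S : Plant p s n m) (x : ZeroSpace p s n × ℝ) : ZeroSpace p s n :=
  WithLp.toLp 2 (S.exoField x.1.fst, S.f₀ x.1 + x.2 • S.f₁ x.1 x.2)

theorem forcedField_zero (S : Plant p s n m) : (fun z => S.forcedField (z, 0)) = S.zeroField := by
  ext z : 1
  simp [forcedField, zeroField]

theorem auxField_eq [NeZero m] (S : Plant p s n m) (g : ℝ) (a : Fin m → ℝ)
    (x : AuxSpace p s n m) :
    S.auxField g a x = WithLp.toLp 2 (S.forcedField (x.fst, x.snd 0), errorField g a x.snd) := rfl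

theorem contDiff_exoField (S : Plant p s n m) : ContDiff ℝ 1 S.exoField :=
  ContDiff.withLp_toLp contDiff_const S.contDiff_exo

theorem contDiff_forcedField (S : Plant p s n m) : ContDiff ℝ 1 S.forcedField :=
  ContDiff.withLp_toLp (S.contDiff_exoField.comp (contDiff_withLp_fst.comp contDiff_fst))
    ((S.contDiff_f₀.comp contDiff_fst).add (contDiff_snd.smul S.contDiff_f₁))

theorem contDiff_auxField [NeZero m] (S : Plant p s n m) (g : ℝ) (a : Fin m → ℝ) :
    ContDiff ℝ 1 (S.auxField g a) :=
  ContDiff.withLp_toLp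
    (S.contDiff_forcedField.comp (contDiff_withLp_fst.prodMk
      ((EuclideanSpace.proj (𝕜 := ℝ) (0 : Fin m)).contDiff.comp contDiff_withLp_snd)))
    ((errorMap g a).contDiff.comp contDiff_withLp_snd)

theorem isForcedInvariant (S : Plant p s n m) {W : Set (ExoSpace p s)}
    (hW : IsInvariantSet S.exoField W) :
    IsForcedInvariant S.forcedField (prodSet W Set.univ) := by
  intro u z T hT hz hz0
  obtain ⟨w, hw, hw0, hwW⟩ := hW _ hz0.1
  have h1 : IsIntegralCurveOn (fun t => (z t).fst) (fun _ => S.exoField) (Icc 0 T) :=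
    fun t ht => hz.withLp_fst ht
  have h2 := IsIntegralCurveOn.eqOn_Icc_of_contDiff S.contDiff_exoField h1
    (hw.isIntegralCurveOn (Icc 0 T)) hw0.symm ⟨hT, le_rfl⟩
  exact ⟨by rw [show (z T).fst = w T from h2]; exact hwW T, trivial⟩

theorem auxFriend_of_snd_eq_zero {S : Plant p s n m} {g : ℝ} {a : Fin m → ℝ}
    {x : AuxSpace p s n m} (hx : x.snd = 0) :
    S.auxFriend g a x = S.friend x.fst := by
  have h0 : fullError g a (0 : Euc m) 0 = 0 := by
    ext i
    refine Fin.lastCases ?_ (fun i => ?_) i <;> simp [fullError, gainSum]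
  simp [auxFriend, auxQ, friend, hx, h0]

variable [NeZero m] {S : Plant p s n m} {g : ℝ} {a : Fin m → ℝ}

theorem isForwardSolution_auxField {z : ℝ → ZeroSpace p s n} {e : ℝ → Euc m}
    (hz : IsIntegralCurveOn z (fun t x => S.forcedField (x, e t 0)) (Ici 0))
    (he : IsForwardSolution (errorField g a) e) :
    IsForwardSolution (S.auxField g a) fun t => WithLp.toLp 2 (z t, e t) :=
  fun t ht => (hz t ht).withLp_toLp (he t ht)

theorem isForwardSolution_snd {x : ℝ → AuxSpace p s n m}
    (hx : IsForwardSolution (S.auxField g a) x) :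
    IsForwardSolution (errorField g a) fun t => (x t).snd :=
  fun _ ht => IsIntegralCurveOn.withLp_snd hx ht

/-- The cascade structure: the solutions of the transformed zero dynamics are obtained by first
solving for the error and then for `𝐳`. -/
theorem exists_auxField_solution {x₀ : AuxSpace p s n m}
    {Q : (ℝ → ZeroSpace p s n) → Prop}
    (h : ∀ e : ℝ → Euc m, Continuous e → IsForwardSolution (errorField g a) e → e 0 = x₀.snd →
      ∃ z : ℝ → ZeroSpace p s n, z 0 = x₀.fst ∧
        IsIntegralCurveOn z (fun t x => S.forcedField (x, e t 0)) (Ici 0) ∧ Q z) :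
    ∃ x : ℝ → AuxSpace p s n m, x 0 = x₀ ∧ IsForwardSolution (S.auxField g a) x ∧
      Q (fun t => (x t).fst) := by
  obtain ⟨e, hec, he, he0⟩ := exists_isForwardSolution_errorField g a x₀.snd
  obtain ⟨z, hz0, hz, hQ⟩ := h e hec he he0
  refine ⟨fun t => WithLp.toLp 2 (z t, e t), ?_, isForwardSolution_auxField hz he, hQ⟩
  simp only [hz0, he0]
  rfl

theorem mem_prodSet_of_isForwardSolution {W : Set (ExoSpace p s)}
    (hW : IsInvariantSet S.exoField W) {x : ℝ → AuxSpace p s n m}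
    (hx : IsForwardSolution (S.auxField g a) x) (hx0 : (x 0).fst ∈ prodSet W Set.univ) {t : ℝ}
    (ht : 0 ≤ t) : (x t).fst ∈ prodSet W Set.univ := by
  refine S.isForcedInvariant hW (fun t => (x t).snd 0) (fun t => (x t).fst) t ht ?_ hx0
  exact IsIntegralCurveOn.mono (s := Ici 0) (fun _ ht => IsIntegralCurveOn.withLp_fst hx ht)
    Icc_subset_Ici_self

theorem auxField_of_snd_eq_zero {x : AuxSpace p s n m} (hx : x.snd = 0) :
    (S.auxField g a x).fst = S.zeroField x.fst := by
  rw [auxField_eq, hx, ← forcedField_zero]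
  simp

end OutputRegulation.Plant

theorem norm_le_of_mem_cube {m : ℕ} {c : ℝ} {e : Euc m} (he : e ∈ cube m c) (hc : 0 ≤ c) :
    ‖e‖ ≤ √m * c := by
  rw [EuclideanSpace.norm_eq]
  refine Real.sqrt_le_iff.2 ⟨by positivity, ?_⟩
  rw [mul_pow, Real.sq_sqrt (by positivity)]
  calc ∑ i, ‖e i‖ ^ 2 ≤ ∑ _i : Fin m, c ^ 2 := by
        gcongr with i
        exact he i
    _ = m * c ^ 2 := by simp

theorem zero_mem_cube (m : ℕ) {c : ℝ} (hc : 0 ≤ c) : (0 : Euc m) ∈ cube m c := fun i => by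
  simpa using hc

/-! ### The transformed zero dynamics for large gains -/

/-- If `M` is nonempty, then so is the limit set: if it were empty, then all distances to it would
be `0` by convention, so that `M` would lie in `B`, and `B` has limit points unless it is empty. -/
theorem limitSet_nonempty_of_mem {X : Type*} [NormedAddCommGroup X] [NormedSpace ℝ X] {ν : ℕ∞}
    {F : X → X} {M B K : Set X} {d₁ : ℝ} (h : AssumptionII ν F M B K d₁) {x : X} (hx : x ∈ M) :
    (limitSet F B).Nonempty := by
  by_contra hne
  refine hne (limitSet_nonempty h.isCompact h.orbit_subset h.forwardComplete
    ⟨x, h.near x hx ?_⟩)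
  rw [Set.not_nonempty_iff_eq_empty.1 hne, Metric.infDist_empty]
  exact h.pos.le

section

variable {p s n m : ℕ} [NeZero m] {S : Plant p s n m} {ν : ℕ∞} {W : Set (ExoSpace p s)}
  {Z : Set (Euc n)} {c : ℝ} {a : Fin m → ℝ} {K : Set (ZeroSpace p s n)} {d₁ N α d₂ δ : ℝ}

/-- For large gains, the solutions of the transformed zero dynamics that start in `𝐙 × Z_e` exist
for all times, remain in a bounded set over a small neighbourhood of `K`, and converge uniformly
to `𝒜₀ × {0}`. -/
theorem exists_gain_semiglobal (hc : 0 < c) (ha : IsHurwitz a)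
    (hW : IsInvariantSet S.exoField W)
    (hii : AssumptionII ν S.zeroField (prodSet W univ) (prodSet W Z) K d₁)
    (hiii : AssumptionIII S.zeroField (prodSet W univ)
      (limitSet S.zeroField (prodSet W Z)) d₁ N α d₂) (hδ : 0 < δ) :
    ∃ gstar : ℝ, 1 ≤ gstar ∧ ∀ g, gstar ≤ g → ∃ R C γ T : ℝ, 0 < γ ∧
      ∀ x₀ ∈ prodSet (prodSet W Z) (cube m c), ∃ x : ℝ → AuxSpace p s n m, x 0 = x₀ ∧
        IsForwardSolution (S.auxField g a) x ∧
        (∀ t, 0 ≤ t → (x t).fst ∈ Metric.cthickening δ K ∧ ‖(x t).snd‖ ≤ R) ∧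
        ∀ t, T ≤ t →
          Metric.infDist (x t).fst (limitSet S.zeroField (prodSet W Z)) ≤
            C * Real.exp (-γ * t) ∧
          ‖(x t).snd‖ ≤ R * Real.exp (-γ * t) := by
  obtain ⟨C₀, l, hC₀, hl, herr⟩ := exists_error_le ha
  rw [← S.forcedField_zero] at hii hiii ⊢
  set r := C₀ * (√m * c) + 1 with hr
  have hr0 : 0 < r := by positivity
  obtain ⟨μ, hμ, hsemi⟩ := exists_forced_semiglobal S.contDiff_forcedField
    (S.isForcedInvariant hW) (fun x hx => ⟨hx.1, trivial⟩) hii hiii hδ hr0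
  refine ⟨max 1 (μ / l), le_max_left _ _, fun g hg => ?_⟩
  have hg1 : 1 ≤ g := (le_max_left _ _).trans hg
  have hg0 : 0 < g := by linarith
  have hμg : μ ≤ l * g := by
    have := (le_max_right _ _).trans hg
    rwa [div_le_iff₀' hl] at this
  obtain ⟨C, γ, T, hγ, hz⟩ := hsemi (l * g) hμg
  have hlg : 0 < l * g := by positivity
  have key : ∀ e : ℝ → Euc m, IsForwardSolution (Plant.errorField g a) e → e 0 ∈ cube m c →
      ∀ t, 0 ≤ t → |e t 0| ≤ r * Real.exp (-(l * g) * t) ∧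
        ‖e t‖ ≤ m * g ^ m * r * Real.exp (-(l * g) * t) := by
    intro e he he0 t ht
    obtain ⟨h1, h2⟩ := herr g hg1 e he t ht
    have h3 : C₀ * ‖e 0‖ ≤ r := by
      have := mul_le_mul_of_nonneg_left (norm_le_of_mem_cube he0 hc.le) hC₀.le
      linarith
    refine ⟨h1.trans (by gcongr), h2.trans ?_⟩
    rw [mul_assoc (_ * _) r]
    gcongr
  refine ⟨m * g ^ m * r, max C 0, min γ (l * g), max T 0, by positivity, fun x₀ hx₀ => ?_⟩
  obtain ⟨x, hx0, hx, hV, hT⟩ := Plant.exists_auxField_solution (S := S) (g := g) (a := a)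
    (x₀ := x₀) (fun e hec he he0 => hz (fun t => e t 0) (by fun_prop)
      (fun t ht => (key e he (he0 ▸ hx₀.2) t ht).1) x₀.fst hx₀.1)
  have hsnd := fun t ht => (key _ (Plant.isForwardSolution_snd hx)
    (show (x 0).snd ∈ cube m c from hx0 ▸ hx₀.2) t ht).2
  refine ⟨x, hx0, hx, fun t ht => ⟨hV t ht, (hsnd t ht).trans ?_⟩, fun t ht => ⟨?_, ?_⟩⟩
  · exact mul_le_of_le_one_right (by positivity) (Real.exp_le_one_iff.2 (by nlinarith))
  · have ht0 : 0 ≤ t := (le_max_right _ _).trans ht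
    refine (hT t ((le_max_left _ _).trans ht)).trans ?_
    gcongr
    · exact le_max_left _ _
    · exact min_le_left _ _
  · have ht0 : 0 ≤ t := (le_max_right _ _).trans ht
    refine (hsnd t ht0).trans ?_
    gcongr
    exact min_le_right _ _

/-- The set `𝒜₀ × {0}` is locally exponentially attractive for the transformed zero dynamics. -/
theorem exists_assumptionIII_auxField (ha : IsHurwitz a)
    (hW : IsInvariantSet S.exoField W)
    (hii : AssumptionII ν S.zeroField (prodSet W univ) (prodSet W Z) K d₁)
    (hiii : AssumptionIII S.zeroField (prodSet W univ)
      (limitSet S.zeroField (prodSet W Z)) d₁ N α d₂) {g : ℝ} (hg : 1 ≤ g) {d' : ℝ} (hd' : 0 < d') :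
    ∃ N' α' d₂' : ℝ, AssumptionIII (S.auxField g a) (prodSet (prodSet W univ) univ)
      (prodSet (limitSet S.zeroField (prodSet W Z)) {0}) d' N' α' d₂' := by
  obtain ⟨C₀, l, hC₀, hl, herr⟩ := exists_error_le ha
  have hne := fun z hz => limitSet_nonempty_of_mem (x := z) hii hz
  have hd₂ := hiii.pos
  rw [← S.forcedField_zero] at hii hiii hne ⊢
  have hg0 : 0 < g := by linarith
  have hlg : 0 < l * g := by positivity
  obtain ⟨C, γ, ε, hC, hγ, hγβ, hε, hloc⟩ := exists_forced_local S.contDiff_forcedField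
    (S.isForcedInvariant hW) hii hiii one_pos hlg
  set A := limitSet (fun z => S.forcedField (z, 0)) (prodSet W Z) with hA
  set D : ℝ := m * g ^ m * C₀ with hD
  refine ⟨C * (1 + C₀) + D + 1, γ, min d' (min d₂ (ε / C₀)),
    ⟨?_, hγ, by positivity, min_le_left _ _, ?_⟩⟩
  · have : 0 ≤ C * (1 + C₀) + D := by positivity
    linarith
  intro x hx hx0 hxd t ht
  have hAne := hne _ hx0.1
  have h1 := infDist_fst_le_infDist_prodSet hAne (x 0)
  have h2 := norm_snd_le_infDist_prodSet hAne (x 0)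
  set δ₀ := Metric.infDist (x 0) (prodSet A {0}) with hδ₀
  have hδ₀0 : 0 ≤ δ₀ := Metric.infDist_nonneg
  have hη : C₀ * ‖(x 0).snd‖ ≤ ε := by
    have h3 := h2.trans (hxd.trans ((min_le_right _ _).trans (min_le_right _ _)))
    rwa [le_div_iff₀' hC₀] at h3
  obtain ⟨y, hy0, hy, hyA⟩ := Plant.exists_auxField_solution (S := S) (g := g) (a := a)
    (x₀ := x 0) (fun e hec he he0 => hloc (fun t => e t 0) (by fun_prop)
      (C₀ * ‖(x 0).snd‖) (by positivity) hη (fun t ht => he0 ▸ (herr g hg e he t ht).1)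
      (x 0).fst hx0.1 (h1.trans (hxd.trans ((min_le_right _ _).trans (min_le_left _ _)))))
  rw [hx.eqOn (S.contDiff_auxField g a) hy hy0.symm ht]
  have h4 := hyA t ht
  have h5 := (herr g hg _ (Plant.isForwardSolution_snd hy) t ht).2
  rw [hy0] at h5
  have h6 : Real.exp (-(l * g) * t) ≤ Real.exp (-γ * t) := by gcongr
  refine (infDist_prodSet_le hAne (y t)).trans ?_
  calc Metric.infDist (y t).fst A + ‖(y t).snd‖
      ≤ C * Real.exp (-γ * t) * (δ₀ + C₀ * δ₀) +
          m * g ^ m * (C₀ * δ₀ * Real.exp (-γ * t)) := by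
        refine add_le_add (h4.trans ?_) (h5.trans ?_) <;> gcongr
    _ = (C * (1 + C₀) + D) * Real.exp (-γ * t) * δ₀ := by rw [hD]; ring
    _ ≤ (C * (1 + C₀) + D + 1) * Real.exp (-γ * t) * δ₀ := by
        exact mul_le_mul_of_nonneg_right
          (mul_le_mul_of_nonneg_right (by linarith) (Real.exp_nonneg _)) hδ₀0

/-- Points of `𝒜₀ × {0}` are limits of solutions with vanishing error. -/
theorem prodSet_limitSet_subset (hc : 0 < c) (g : ℝ) :
    prodSet (limitSet S.zeroField (prodSet W Z)) {0} ⊆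
      limitSet (S.auxField g a) (prodSet (prodSet W Z) (cube m c)) := by
  rintro y ⟨⟨x, t, hx, ht, hy⟩, hy0⟩
  refine ⟨fun k τ => WithLp.toLp 2 (x k τ, 0), t, fun k => ⟨?_, (hx k).2, zero_mem_cube m hc.le⟩,
    ht, ?_⟩
  · refine Plant.isForwardSolution_auxField (e := fun _ => 0) ?_ ?_
    · have h1 := (hx k).1
      rw [← S.forcedField_zero] at h1
      exact h1
    · intro τ _
      beta_reduce
      rw [show Plant.errorField g a (0 : Euc m) = 0 from map_zero (errorMap g a)]
      exact hasDerivWithinAt_const _ _ _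
  · have h1 : Tendsto (fun k => WithLp.toLp 2 (x k (t k), (0 : Euc m))) atTop
        (𝓝 (WithLp.toLp 2 (y.fst, 0))) :=
      ((WithLp.prod_continuous_toLp 2 _ _).tendsto _).comp (hy.prodMk_nhds tendsto_const_nhds)
    have h2 : WithLp.toLp 2 (y.fst, (0 : Euc m)) = y := by
      rw [← show y.snd = 0 from hy0]; rfl
    rwa [h2] at h1

/-- The limit set of the transformed zero dynamics, from the uniform convergence of the solutions
to `𝒜₀ × {0}`. -/
theorem limitSet_auxField_eq (hc : 0 < c)
    (hii : AssumptionII ν S.zeroField (prodSet W univ) (prodSet W Z) K d₁) {g R C γ T : ℝ}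
    (hγ : 0 < γ)
    (h : ∀ x : ℝ → AuxSpace p s n m, IsForwardSolution (S.auxField g a) x →
      x 0 ∈ prodSet (prodSet W Z) (cube m c) → ∀ t, T ≤ t →
        Metric.infDist (x t).fst (limitSet S.zeroField (prodSet W Z)) ≤ C * Real.exp (-γ * t) ∧
        ‖(x t).snd‖ ≤ R * Real.exp (-γ * t)) :
    limitSet (S.auxField g a) (prodSet (prodSet W Z) (cube m c)) =
      prodSet (limitSet S.zeroField (prodSet W Z)) {0} := by
  refine Subset.antisymm ?_ (prodSet_limitSet_subset hc g)
  rintro y ⟨x, t, hx, ht, hy⟩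
  have hexp : ∀ D : ℝ, Tendsto (fun k => D * Real.exp (-γ * t k)) atTop (𝓝 0) := by
    intro D
    have h1 : Tendsto (fun k => -γ * t k) atTop atBot :=
      ht.const_mul_atTop_of_neg (neg_neg_of_pos hγ)
    simpa using (Real.tendsto_exp_atBot.comp h1).const_mul D
  have hfst : Tendsto (fun k => (x k (t k)).fst) atTop (𝓝 y.fst) :=
    ((WithLp.fstL 2 ℝ _ _).continuous.tendsto y).comp hy
  have hsnd : Tendsto (fun k => (x k (t k)).snd) atTop (𝓝 y.snd) :=
    ((WithLp.sndL 2 ℝ _ _).continuous.tendsto y).comp hy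
  have hne := limitSet_nonempty hii.isCompact hii.orbit_subset hii.forwardComplete
    ⟨_, (hx 0).2.1⟩
  have hev := ht.eventually_ge_atTop T
  constructor
  · rw [(isClosed_limitSet _ _).mem_iff_infDist_zero hne]
    refine tendsto_nhds_unique (((Metric.continuous_infDist_pt _).tendsto _).comp hfst)
      (squeeze_zero' (Eventually.of_forall fun _ => Metric.infDist_nonneg) ?_ (hexp C))
    filter_upwards [hev] with k hk using (h _ (hx k).1 (hx k).2 _ hk).1
  · refine tendsto_nhds_unique hsnd (squeeze_zero_norm' ?_ (hexp R))
    filter_upwards [hev] with k hk using (h _ (hx k).1 (hx k).2 _ hk).2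

/-- The map `τ` of the original zero dynamics, as a function that does not depend on the error, has
the immersion property for the transformed zero dynamics. -/
theorem immersion_auxField {d k : ℕ} {𝒜 : Matrix (Fin d) (Fin d) ℝ}
    {𝒞 : Matrix (Fin 1) (Fin d) ℝ} {φ : ℝ → Fin d → ℝ} {Ω : ℝ → Matrix (Fin d) (Fin k) ℝ}
    {θ : Euc p → Fin k → ℝ} {τ : ZeroSpace p s n → Fin d → ℝ} {g : ℝ}
    {A U : Set (ZeroSpace p s n)} (hAK : A ⊆ K)
    (h : Immersion 𝒜 𝒞 φ Ω θ S.zeroField S.friend (fun z => z.fst.fst) K A τ)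
    (hU : IsOpen U) (hKU : K ⊆ U) (hτ : ContDiffOn ℝ 1 τ U) {Kt : Set (AuxSpace p s n m)}
    (hKt : ∀ x ∈ Kt, x.fst ∈ U) :
    Immersion 𝒜 𝒞 φ Ω θ (S.auxField g a) (S.auxFriend g a) (fun x => x.fst.fst.fst) Kt
      (prodSet A {0}) (fun x => τ x.fst) where
  isC1On := ⟨{x | x.fst ∈ U}, hU.preimage (WithLp.fstL 2 ℝ _ _).continuous, hKt,
    hτ.comp contDiff_withLp_fst.contDiffOn fun _ hx => hx⟩
  deriv_eq := fun x hx => by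
    have hd : DifferentiableAt ℝ τ x.fst :=
      (hτ.differentiableOn one_ne_zero).differentiableAt (hU.mem_nhds (hKU (hAK hx.1)))
    rw [fderiv_comp_withLp_fst hd, Plant.auxField_of_snd_eq_zero hx.2, h.deriv_eq x.fst hx.1]
  output_eq := fun x hx => by
    rw [Plant.auxFriend_of_snd_eq_zero hx.2, h.output_eq x.fst hx.1]

end

end

theorem mainTheorem4
    -- the smoothness class of the submanifolds
    (ν : ℕ∞) (hν : 1 ≤ ν)
    -- the plant, of relative degree `r = m + 1 ≥ 2`
    {p s n m : ℕ} [NeZero m] (S : Plant p s n m)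
    -- the parameter set and the sets of initial conditions
    (P : Set (Euc p)) (hP : IsCompact P)
    (W : Set (ExoSpace p s)) (hW : IsCompact W) (hWP : ∀ w ∈ W, w.fst ∈ P)
    (Z : Set (Euc n)) (hZ : IsCompact Z)
    (c : ℝ) (hc : 0 < c)
    -- the coefficients of the change of variable
    (a : Fin m → ℝ) (ha : IsHurwitz a)
    -- assumption (i)
    (hWman : IsSubmanifoldWithBoundary ν W) (hWinv : IsInvariantSet S.exoField W)
    -- assumption (ii)
    (K : Set (ZeroSpace p s n)) (d₁ : ℝ)
    (hii : AssumptionII ν S.zeroField (prodSet W Set.univ) (prodSet W Z) K d₁)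
    -- assumption (iii)
    (N α d₂ : ℝ)
    (hiii : AssumptionIII S.zeroField (prodSet W Set.univ)
      (limitSet S.zeroField (prodSet W Z)) d₁ N α d₂)
    -- assumption (iv)
    {d k : ℕ} (hd : 0 < d)
    (𝒜 : Matrix (Fin d) (Fin d) ℝ) (𝒞 : Matrix (Fin 1) (Fin d) ℝ) (hobs : IsObservable 𝒜 𝒞)
    (φ : ℝ → Fin d → ℝ) (hφ : ContDiff ℝ 1 φ)
    (Ω : ℝ → Matrix (Fin d) (Fin k) ℝ) (hΩ : ∀ i j, ContDiff ℝ 1 (fun y => Ω y i j))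
    (θ : Euc p → Fin k → ℝ) (hθ : ContinuousOn θ P)
    (τ : ZeroSpace p s n → Fin d → ℝ)
    (hiv : Immersion 𝒜 𝒞 φ Ω θ S.zeroField S.friend (fun z => z.fst.fst) K
      (limitSet S.zeroField (prodSet W Z)) τ) :
    ∃ gstar : ℝ, 0 < gstar ∧ ∀ g : ℝ, gstar ≤ g →
      -- the limit set of the transformed zero dynamics is `𝒜₀ × {0}`
      limitSet (S.auxField g a) (prodSet (prodSet W Z) (cube m c)) =
        prodSet (limitSet S.zeroField (prodSet W Z)) {0} ∧
      ∃ (Kt : Set (AuxSpace p s n m)) (dt₁ Nt αt dt₂ : ℝ) (τt : AuxSpace p s n m → Fin d → ℝ),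
        -- (ii)', where the compact set is moreover positively invariant
        AssumptionII ν (S.auxField g a) (prodSet (prodSet W Set.univ) Set.univ)
          (prodSet (prodSet W Z) (cube m c)) Kt dt₁ ∧
        IsPositivelyInvariantSet (S.auxField g a) Kt ∧
        -- (iii)'
        AssumptionIII (S.auxField g a) (prodSet (prodSet W Set.univ) Set.univ)
          (limitSet (S.auxField g a) (prodSet (prodSet W Z) (cube m c))) dt₁ Nt αt dt₂ ∧
        -- (iv)'
        Immersion 𝒜 𝒞 φ Ω θ (S.auxField g a) (S.auxFriend g a) (fun x => x.fst.fst.fst) Kt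
          (limitSet (S.auxField g a) (prodSet (prodSet W Z) (cube m c))) τt := by
  obtain ⟨U, hU, hKU, hτU⟩ := hiv.isC1On
  obtain ⟨δ, hδ, hδU⟩ := hii.isCompact.exists_cthickening_subset_open hU hKU
  obtain ⟨gstar, hgstar, hsemi⟩ := exists_gain_semiglobal hc ha hWinv hii hiii hδ
  refine ⟨gstar, by linarith, fun g hg => ?_⟩
  obtain ⟨R, C, γ, T, hγ, hsol⟩ := hsemi g hg
  have hF := S.contDiff_auxField g a
  -- by uniqueness, the bounds hold along every solution that starts in `𝐙 × Z_e`
  have hV : ∀ x : ℝ → AuxSpace p s n m, IsForwardSolution (S.auxField g a) x →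
      x 0 ∈ prodSet (prodSet W Z) (cube m c) → ∀ t, 0 ≤ t →
        (x t).fst ∈ Metric.cthickening δ K ∧ ‖(x t).snd‖ ≤ R := by
    intro x hx hx0 t ht
    obtain ⟨y, hy0, hy, hyV, -⟩ := hsol _ hx0
    rw [hx.eqOn hF hy hy0.symm ht]
    exact hyV t ht
  have hlim : ∀ x : ℝ → AuxSpace p s n m, IsForwardSolution (S.auxField g a) x →
      x 0 ∈ prodSet (prodSet W Z) (cube m c) → ∀ t, max T 0 ≤ t →
        Metric.infDist (x t).fst (limitSet S.zeroField (prodSet W Z)) ≤ C * Real.exp (-γ * t) ∧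
        ‖(x t).snd‖ ≤ R * Real.exp (-γ * t) := by
    intro x hx hx0 t ht
    obtain ⟨y, hy0, hy, -, hyT⟩ := hsol _ hx0
    rw [hx.eqOn hF hy hy0.symm ((le_max_right _ _).trans ht)]
    exact hyT t ((le_max_left _ _).trans ht)
  have hEq := limitSet_auxField_eq hc hii hγ hlim
  have hcont : Continuous (WithLp.fst : AuxSpace p s n m → ZeroSpace p s n) :=
    (WithLp.fstL 2 ℝ _ _).continuous
  set O := positiveOrbit (S.auxField g a) (prodSet (prodSet W Z) (cube m c)) with hO
  have hOV : ∀ y ∈ O, y.fst ∈ Metric.cthickening δ K ∧ ‖y.snd‖ ≤ R := by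
    rintro _ ⟨x, hx, hx0, t, ht, rfl⟩
    exact hV x hx hx0 t ht
  have hOM : ∀ y ∈ O, y.fst ∈ prodSet W Set.univ := by
    rintro _ ⟨x, hx, hx0, t, ht, rfl⟩
    exact Plant.mem_prodSet_of_isForwardSolution hWinv hx ⟨hx0.1.1, trivial⟩ ht
  have hOb : Bornology.IsBounded O := by
    obtain ⟨R', hR'⟩ := isBounded_iff_forall_norm_le.1 hii.isCompact.isBounded.cthickening
    refine isBounded_iff_forall_norm_le.2 ⟨R' + R, fun y hy => ?_⟩
    have h1 : y = WithLp.toLp 2 (y.fst, (0 : Euc m)) +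
        WithLp.toLp 2 ((0 : ZeroSpace p s n), y.snd) := by
      apply (WithLp.equiv 2 _).injective
      ext : 1 <;> simp
    rw [h1]
    refine (norm_add_le _ _).trans ?_
    rw [WithLp.norm_toLp_fst, WithLp.norm_toLp_snd]
    exact add_le_add (hR' _ (hOV y hy).1) (hOV y hy).2
  have hMc : IsClosed {y : AuxSpace p s n m | y.fst ∈ prodSet W Set.univ} := by
    have h1 : IsClosed {y : AuxSpace p s n m | y.fst.fst ∈ W} :=
      hW.isClosed.preimage ((WithLp.fstL 2 ℝ _ _).continuous.comp hcont)
    simpa [prodSet] using h1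
  have hd₁ := hii.pos
  obtain ⟨Nt, αt, dt₂, hAtt⟩ := exists_assumptionIII_auxField ha hWinv hii hiii
    (hgstar.trans hg) (lt_min hd₁ hc)
  have hAK := limitSet_subset_of_isCompact hii.isCompact hii.orbit_subset
  rw [hEq]
  refine ⟨rfl, closure O, min d₁ c, Nt, αt, dt₂, fun x => τ x.fst, ?_,
    isPositivelyInvariantSet_closure hF (isPositivelyInvariantSet_positiveOrbit hF _) hOb,
    hAtt, ?_⟩
  · refine ⟨?_, ?_, ?_, subset_closure, ?_, ?_, lt_min hd₁ hc, ?_⟩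
    · have : ProperSpace (AuxSpace p s n m) := FiniteDimensional.proper_real _
      exact Metric.isCompact_of_isClosed_isBounded isClosed_closure hOb.closure
    · exact fun y hy => ⟨closure_minimal hOM hMc hy, trivial⟩
    · intro x₀ hx₀
      obtain ⟨x, hx0, hx, -⟩ := hsol x₀ hx₀
      exact ⟨x, hx, hx0⟩
    · rw [hEq]
      exact fun y hy => ⟨hii.limitSet_subset hy.1, trivial⟩
    · rw [hEq]
      exact isSubmanifoldWithBoundary_prodSet_zero hii.limitSet_submanifold
    · intro x hx hxd
      rw [hEq] at hxd
      have hne := limitSet_nonempty_of_mem hii hx.1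
      refine ⟨hii.near _ hx.1 ((infDist_fst_le_infDist_prodSet hne x).trans
        (hxd.trans (min_le_left _ _))), fun i => ?_⟩
      exact (PiLp.norm_apply_le x.snd i).trans ((norm_snd_le_infDist_prodSet hne x).trans
        (hxd.trans (min_le_right _ _)))
  · exact immersion_auxField hAK hiv hU hKU hτU fun x hx => hδU
      (closure_minimal (fun y hy => (hOV y hy).1)
        (Metric.isClosed_cthickening.preimage hcont) hx)
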